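/- **Setting.** A knot is (the trace of) a continuous injective closed curve $\mathbb R/\mathbb Z\to\mathbb R^3$, and a knot class $\mathcal K$ is an ambient isotopy class of knots; $\mathcal K$ is called tame if it contains a polygon, i.e. a piecewise affine loop. Let $\mathscr C(\mathcal K)$ be the set of unit loops representing $\mathcal K$, that is, of all $\gamma\in H^2(\mathbb R/\mathbb Z,\mathbb R^3)$ (identified with their $C^1$ representatives) such that $\gamma(0)=0$, $|\gamma'|\equiv 1$ on $\mathbb R/\mathbb Z$, and $\gamma$ is of knot type $\mathcal K$. For $\gamma\in\mathscr C(\mathcal K)$ put $$E_{\mathrm{bend}}(\gamma)=\int_{\mathbb R/\mathbb Z}|\gamma''|^2\,dt,\qquad \triangle[\gamma]=\inf_{u\neq v\neq w\neq u}R(\gamma(u),\gamma(v),\gamma(w)),\qquad \mathcal R(\gamma)=\frac{\operatorname{length}(\gamma)}{\triangle[\gamma]}=\frac1{\triangle[\gamma]}\in(0,\infty],$$ where $\gamma''$ is the weak second derivative, the infimum is over pairwise distinct $u,v,w\in\mathbb R/\mathbb Z$, $R(x,y,z)$ is the radius of the circle through the points $x,y,z$ ($R=\infty$ if they are distinct and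 collinear, and the smallest possible radius if some of them coincide), and $\mathcal R(\gamma)=\infty$ if $\triangle[\gamma]=0$. For $\theta>0$ let $E_\theta=E_{\mathrm{bend}}+\theta\,\mathcal R$, with values in $[0,\infty]$. **Theorem (Minimizing the total energy).** For every tame knot class $\mathcal K$ and every $\theta>0$ there exists a unit loop $\gamma_\theta\in\mathscr C(\mathcal K)$ such that $$E_\theta(\gamma_\theta)=\inf_{\gamma\in\mathscr C(\mathcal K)}E_\theta(\gamma).$$ -/

import Mathlib

open MeasureTheory Set
open scoped ENNReal NNReal ContDiff unitInterval

namespace SpringyKnots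

/-- Euclidean three-space. -/
abbrev E3 : Type := EuclideanSpace ℝ (Fin 3)

/-! ### Knot classes -/

/-- A knot: a closed curve in `ℝ³`, continuous and without self-intersections (by compactness,
an embedding of the circle `ℝ / ℤ`). -/
structure Knot where
  toFun : UnitAddCircle → E3
  continuous' : Continuous toFun
  injective' : Function.Injective toFun

/-- The subsets `A`, `B` of `ℝ³` are ambient isotopic: there is a family `H t`, `t ∈ [0, 1]`, of
homeomorphisms of `ℝ³`, jointly continuous in `(t, x)`, with `H 0 = id` and `H 1` mapping `A`
onto `B`. -/
def AmbientIsotopic (A B : Set E3) : Prop :=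
  ∃ H : I → (E3 ≃ₜ E3),
    Continuous (fun p : I × E3 => H p.1 p.2) ∧ (∀ x, H 0 x = x) ∧ (fun x => H 1 x) '' A = B

theorem AmbientIsotopic.refl (A : Set E3) : AmbientIsotopic A A :=
  ⟨fun _ => Homeomorph.refl E3, continuous_snd, fun _ => rfl, by simp⟩

theorem AmbientIsotopic.symm {A B : Set E3} (h : AmbientIsotopic A B) : AmbientIsotopic B A := by
  obtain ⟨H, hc, h0, h1⟩ := h
  refine ⟨fun t => (H 1).symm.trans (H (unitInterval.symm t)), ?_, fun x => ?_, ?_⟩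
  · exact hc.comp ((unitInterval.continuous_symm.comp continuous_fst).prodMk
      ((H 1).symm.continuous.comp continuous_snd))
  · simp
  · subst h1
    simp [Set.image_image, h0]

theorem AmbientIsotopic.trans {A B C : Set E3} (h : AmbientIsotopic A B)
    (h' : AmbientIsotopic B C) : AmbientIsotopic A C := by
  obtain ⟨H, hc, h0, h1⟩ := h
  obtain ⟨G, gc, g0, g1⟩ := h'
  refine ⟨fun t => (H t).trans (G t), ?_, fun x => ?_, ?_⟩
  · exact gc.comp (continuous_fst.prodMk hc)
  · simp [h0, g0]
  · subst h1 g1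
    simp [Set.image_image]

/-- Two knots are equivalent if their traces in `ℝ³` are ambient isotopic. -/
instance Knot.setoid : Setoid Knot where
  r k l := AmbientIsotopic (range k.toFun) (range l.toFun)
  iseqv := ⟨fun _ => AmbientIsotopic.refl _, AmbientIsotopic.symm, AmbientIsotopic.trans⟩

/-- A knot class: an ambient isotopy class of knots. -/
def KnotClass : Type := Quotient Knot.setoid

/-- `γ` is a (closed) polygon, i.e. a piecewise affine linear loop: there is a subdivision
`0 = t₀ ≤ t₁ ≤ … ≤ tₙ = 1` such that `γ` is affine on each `[tᵢ, tᵢ₊₁]`. -/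
def IsPolygon (γ : UnitAddCircle → E3) : Prop :=
  ∃ (n : ℕ) (t : ℕ → ℝ), Monotone t ∧ t 0 = 0 ∧ t n = 1 ∧
    ∀ i < n, ∀ s ∈ Icc (0 : ℝ) 1,
      γ ((AffineMap.lineMap (t i) (t (i + 1)) s : ℝ) : UnitAddCircle) =
        AffineMap.lineMap (γ (t i : UnitAddCircle)) (γ (t (i + 1) : UnitAddCircle)) s

/-- A knot class is tame if it contains a polygon. -/
def KnotClass.IsTame (K : KnotClass) : Prop :=
  ∃ k : Knot, IsPolygon k.toFun ∧ (Quotient.mk Knot.setoid k : KnotClass) = K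

/-- The closed curve `γ` is a knot and belongs to the knot class `K`. -/
def IsOfKnotType (γ : UnitAddCircle → E3) (K : KnotClass) : Prop :=
  ∃ k : Knot, k.toFun = γ ∧ (Quotient.mk Knot.setoid k : KnotClass) = K

/-! ### Sobolev loops -/

/-- `g` is a weak derivative of `f` on `ℝ / ℤ`, tested against smooth `1`-periodic functions. -/
def HasWeakDeriv (f g : UnitAddCircle → E3) : Prop :=
  ∀ φ : ℝ → ℝ, ContDiff ℝ ∞ φ → Function.Periodic φ 1 →
    ∫ t in (0 : ℝ)..1, deriv φ t • f (t : UnitAddCircle) =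
      -∫ t in (0 : ℝ)..1, φ t • g (t : UnitAddCircle)

/-- `γ ∈ H²(ℝ / ℤ, ℝ³)`: `γ`, its weak derivative and its second weak derivative are square
integrable. As usual, `γ` is identified with its continuous representative. -/
def MemH2 (γ : UnitAddCircle → E3) : Prop :=
  Continuous γ ∧ MemLp γ 2 volume ∧
    ∃ g₁ g₂ : UnitAddCircle → E3, MemLp g₁ 2 volume ∧ MemLp g₂ 2 volume ∧
      HasWeakDeriv γ g₁ ∧ HasWeakDeriv g₁ g₂

open scoped Classical in
/-- The square integrable weak derivative of `f` (unique up to null sets), if there is one. -/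
noncomputable def weakDeriv (f : UnitAddCircle → E3) : UnitAddCircle → E3 :=
  if h : ∃ g : UnitAddCircle → E3, MemLp g 2 volume ∧ HasWeakDeriv f g then h.choose else 0

/-- The velocity `γ'` of a closed curve `γ : ℝ / ℤ → ℝ³`, as a `1`-periodic function on `ℝ`. -/
noncomputable def velocity (γ : UnitAddCircle → E3) (t : ℝ) : E3 :=
  deriv (fun s : ℝ => γ (s : UnitAddCircle)) t

/-- The class of unit loops representing `K`: all arclength parametrised `H²` loops `γ` of length
one and knot type `K` with `γ 0 = 0`. -/
def unitLoops (K : KnotClass) : Set (UnitAddCircle → E3) :=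
  {γ | MemH2 γ ∧ γ 0 = 0 ∧ (∀ t : ℝ, ‖velocity γ t‖ = 1) ∧ IsOfKnotType γ K}

/-! ### Energies -/

/-- The bending energy of a loop parametrised by arclength: the integral of the squared curvature
`κ² = |γ''|²`, where `γ''` is the second weak derivative. -/
noncomputable def bendingEnergy (γ : UnitAddCircle → E3) : ℝ≥0∞ :=
  ∫⁻ t, ‖weakDeriv (weakDeriv γ) t‖ₑ ^ 2

/-- `x`, `y`, `z` lie on a common circle of radius `r` in `ℝ³`: the circle has centre `c` and lies
in the plane through `c` with normal `n`. -/
def OnCircleOfRadius (x y z : E3) (r : ℝ≥0) : Prop :=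
  ∃ c n : E3, n ≠ 0 ∧
    ∀ p ∈ ({x, y, z} : Set E3), inner ℝ n (p - c) = 0 ∧ dist p c = r

/-- `R(x, y, z)`: the radius of the circle through `x`, `y`, `z`. It is `∞` for three distinct
collinear points (no circle passes through them), and the smallest possible radius if points
coincide (several circles pass through them). -/
noncomputable def circleRadius (x y z : E3) : ℝ≥0∞ :=
  ⨅ (r : ℝ≥0) (_ : OnCircleOfRadius x y z r), (r : ℝ≥0∞)

/-- The thickness `△[γ]`: the infimum of `R(γ(u), γ(v), γ(w))` over pairwise distinct
parameters. -/
noncomputable def thickness (γ : UnitAddCircle → E3) : ℝ≥0∞ :=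
  ⨅ (u : UnitAddCircle) (v : UnitAddCircle) (w : UnitAddCircle)
    (_ : u ≠ v ∧ v ≠ w ∧ w ≠ u), circleRadius (γ u) (γ v) (γ w)

/-- The length of a (continuously differentiable) closed curve. -/
noncomputable def length (γ : UnitAddCircle → E3) : ℝ≥0∞ :=
  ∫⁻ t in Ioc (0 : ℝ) 1, ‖velocity γ t‖ₑ

/-- Ropelength, the quotient of length and thickness (`∞` if the thickness vanishes). -/
noncomputable def ropelength (γ : UnitAddCircle → E3) : ℝ≥0∞ :=
  length γ / thickness γ

/-- The total energy: bending energy plus `θ` times ropelength. -/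
noncomputable def totalEnergy (θ : ℝ) (γ : UnitAddCircle → E3) : ℝ≥0∞ :=
  bendingEnergy γ + ENNReal.ofReal θ * ropelength γ

end SpringyKnots

/-! The proof is the direct method, and the point is that the knot type survives in the limit. Take
a minimizing sequence, with energies at most `e + 1`. The bending bound and Cauchy–Schwarz make the
unit tangents uniformly Hölder of exponent 1/2; the ropelength bound keeps the thickness above some
`d > 0`. Along an ultrafilter the tangents converge uniformly (Arzelà–Ascoli) and the second
derivatives converge weakly in `L²` (Banach–Alaoglu). The bending energy is weakly lower
semicontinuous. A lower bound on thickness amounts to a closed polynomial condition on triples of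
points (`le_thickness_iff`), so it passes to pointwise limits.

Embeddedness is made quantitative in `UnitSpeedH2.lower_bound`. Nearby points separate because the
tangent turns slowly. For far points, a shortest chord is orthogonal to the curve, and letting two
of three points merge there bounds its length below by `2 * d`. The resulting bi-Lipschitz constant
is uniform in the sequence, so a loop that is `C¹`-close to the limit is joined to it by straight
segments through uniformly bi-Lipschitz curves. Such a homotopy is covered by an ambient isotopy: in
small steps the displacement has small Lipschitz constant on the trace, extends to space, and
perturbs the identity to a homeomorphism (`AmbientIsotopic.of_linear_homotopy`).

If the infimum is `∞`, any loop minimizes, so only nonemptiness of the class remains, with no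
finiteness of energy. An embedded polygon never doubles back, hence locally advances in a fixed
direction. Mollification preserves this monotonicity, so the smoothed curve is an embedding isotopic
to the polygon; rescaling and arclength parametrisation then give a unit loop. -/

namespace SpringyKnots

/-! ### Circles through three points -/

/-- The Gram determinant of two vectors. -/
noncomputable def gram (a b : E3) : ℝ := ‖a‖ ^ 2 * ‖b‖ ^ 2 - inner ℝ a b ^ 2

/-- The three point condition: the circle through `x`, `y`, `z` has radius at least `d`. -/
def ThreePoint (d : ℝ) (x y z : E3) : Prop :=
  4 * d ^ 2 * gram (x - z) (y - z) ≤ ‖x - z‖ ^ 2 * ‖y - z‖ ^ 2 * ‖x - y‖ ^ 2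

theorem gram_nonneg (a b : E3) : 0 ≤ gram a b := by
  have h := abs_real_inner_le_norm a b
  have h2 := sq_le_sq' (by linarith [abs_le.1 h, norm_nonneg a, norm_nonneg b]) (abs_le.1 h).2
  unfold gram
  nlinarith

/-- Three vectors orthogonal to `n ≠ 0` are linearly dependent, and their Gram determinant, which is
the square of the determinant with rows `a`, `b`, `e`, vanishes. -/
theorem gram_det_eq_zero {a b e n : E3} (hn : n ≠ 0) (ha : inner ℝ n a = 0) (hb : inner ℝ n b = 0)
    (he : inner ℝ n e = 0) :
    ‖e‖ ^ 2 * gram a b = inner ℝ a e ^ 2 * ‖b‖ ^ 2 + inner ℝ b e ^ 2 * ‖a‖ ^ 2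
      - 2 * inner ℝ a b * inner ℝ a e * inner ℝ b e := by
  have hdet : (Matrix.of ![(a : Fin 3 → ℝ), b, e]).det = 0 := by
    refine Matrix.exists_mulVec_eq_zero_iff.1 ⟨(n : Fin 3 → ℝ), ?_, ?_⟩
    · intro h
      apply hn
      ext i
      exact congrFun h i
    · simp only [PiLp.inner_apply, Fin.sum_univ_three, RCLike.inner_apply, conj_trivial] at ha hb he
      ext i
      fin_cases i <;> simp [Matrix.mulVec, dotProduct, Fin.sum_univ_three] <;> linarith
  rw [Matrix.det_fin_three] at hdet
  simp at hdet
  simp only [gram, ← real_inner_self_eq_norm_sq, PiLp.inner_apply, Fin.sum_univ_three,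
    RCLike.inner_apply, conj_trivial]
  linear_combination (a 0 * b 1 * e 2 - a 0 * b 2 * e 1 - a 1 * b 0 * e 2 + a 1 * b 2 * e 0
    + a 2 * b 0 * e 1 - a 2 * b 1 * e 0) * hdet

/-- This is "circumradius = product of the sides / (4 · area)", squared and cleared of denominators
so that degenerate triples are allowed. Equidistance from the centre determines the inner products
of the sides with `z - c`; coplanarity then gives the identity. -/
theorem OnCircleOfRadius.formula {x y z : E3} {r : ℝ≥0} (h : OnCircleOfRadius x y z r) :
    4 * (r : ℝ) ^ 2 * gram (x - z) (y - z) = ‖x - z‖ ^ 2 * ‖y - z‖ ^ 2 * ‖x - y‖ ^ 2 := by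
  obtain ⟨c, n, hn, hp⟩ := h
  obtain ⟨x1, x2⟩ := hp x (by simp)
  obtain ⟨y1, y2⟩ := hp y (by simp)
  obtain ⟨z1, z2⟩ := hp z (by simp)
  rw [dist_eq_norm] at x2 y2 z2
  have ea : x - c = (x - z) + (z - c) := by abel
  have eb : y - c = (y - z) + (z - c) := by abel
  have ec : x - y = (x - z) - (y - z) := by abel
  rw [ea] at x1 x2
  rw [eb] at y1 y2
  rw [ec]
  generalize x - z = a at *
  generalize y - z = b at *
  generalize z - c = e at *
  have ha : inner ℝ n a = 0 := by rw [inner_add_right] at x1; linarith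
  have hb : inner ℝ n b = 0 := by rw [inner_add_right] at y1; linarith
  have hd := gram_det_eq_zero hn ha hb z1
  have h1 := norm_add_sq_real a e
  have h2 := norm_add_sq_real b e
  have h3 := norm_sub_sq_real a b
  rw [x2, z2] at h1
  rw [y2, z2] at h2
  rw [z2] at hd
  have h4 : inner ℝ a e = -‖a‖ ^ 2 / 2 := by linarith
  have h5 : inner ℝ b e = -‖b‖ ^ 2 / 2 := by linarith
  rw [h4, h5] at hd
  rw [h3]
  linear_combination 4 * hd

theorem exists_ne_zero_inner_eq_zero (a b : E3) :
    ∃ n : E3, n ≠ 0 ∧ inner ℝ n a = 0 ∧ inner ℝ n b = 0 := by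
  have h1 : Module.finrank ℝ (Submodule.span ℝ ({a, b} : Set E3)) ≤ 2 := by
    have := finrank_span_finset_le_card (R := ℝ) ({a, b} : Finset E3)
    simp only [Finset.coe_insert, Finset.coe_singleton] at this
    exact this.trans Finset.card_le_two
  have h2 := Submodule.finrank_add_finrank_orthogonal (Submodule.span ℝ ({a, b} : Set E3))
  rw [finrank_euclideanSpace_fin] at h2
  have h3 : 0 < Module.finrank ℝ (Submodule.span ℝ ({a, b} : Set E3))ᗮ := by omega
  obtain ⟨⟨n, hn⟩, hn0⟩ := Module.finrank_pos_iff_exists_ne_zero.1 h3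
  refine ⟨n, fun h => hn0 (by simpa using h), ?_, ?_⟩
  · exact Submodule.inner_left_of_mem_orthogonal (Submodule.subset_span (by simp)) hn
  · exact Submodule.inner_left_of_mem_orthogonal (Submodule.subset_span (by simp)) hn

theorem exists_onCircleOfRadius {x y z : E3} (h : 0 < gram (x - z) (y - z)) :
    ∃ r : ℝ≥0, OnCircleOfRadius x y z r := by
  obtain ⟨n, hn, ha, hb⟩ := exists_ne_zero_inner_eq_zero (x - z) (y - z)
  set a := x - z with hadef
  set b := y - z with hbdef
  set G := gram a b with hG
  -- The circumcentre relative to `z`: Cramer's rule for `⟨a, e⟩ = ‖a‖² / 2`, `⟨b, e⟩ = ‖b‖² / 2` in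
  -- the span of `a` and `b`.
  set e : E3 := (‖b‖ ^ 2 * (‖a‖ ^ 2 - inner ℝ a b) / (2 * G)) • a +
    (‖a‖ ^ 2 * (‖b‖ ^ 2 - inner ℝ a b) / (2 * G)) • b with he
  have hGne : G ≠ 0 := h.ne'
  have hGe : G = ‖a‖ ^ 2 * ‖b‖ ^ 2 - inner ℝ a b ^ 2 := rfl
  have hae : inner ℝ a e = ‖a‖ ^ 2 / 2 := by
    rw [he, inner_add_right, inner_smul_right, inner_smul_right, real_inner_self_eq_norm_sq]
    field_simp
    rw [hGe]
    ring
  have hbe : inner ℝ b e = ‖b‖ ^ 2 / 2 := by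
    rw [he, inner_add_right, inner_smul_right, inner_smul_right, real_inner_self_eq_norm_sq,
      real_inner_comm a b]
    field_simp
    rw [hGe]
    ring
  have hne : inner ℝ n e = 0 := by
    rw [he, inner_add_right, inner_smul_right, inner_smul_right, ha, hb]
    ring
  have key : ∀ v : E3, inner ℝ v e = ‖v‖ ^ 2 / 2 → ‖v - e‖ = ‖e‖ := by
    intro v hv
    have h1 := norm_sub_sq_real v e
    rw [hv] at h1
    exact (sq_eq_sq₀ (norm_nonneg _) (norm_nonneg _)).1 (by linarith)
  refine ⟨‖e‖₊, z + e, n, hn, ?_⟩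
  intro p hp
  simp only [mem_insert_iff, mem_singleton_iff] at hp
  rw [dist_eq_norm, coe_nnnorm]
  rcases hp with rfl | rfl | rfl
  · rw [← sub_sub, ← hadef]
    exact ⟨by rw [inner_sub_right, ha, hne, sub_zero], key a hae⟩
  · rw [← sub_sub, ← hbdef]
    exact ⟨by rw [inner_sub_right, hb, hne, sub_zero], key b hbe⟩
  · simp [hne]

theorem gram_self (a : E3) : gram a a = 0 := by
  rw [gram, real_inner_self_eq_norm_sq]; ring

/-- For a collinear triple the infimum is over the empty set and the Gram determinant is zero, so
both sides hold; otherwise a circle exists and the radius formula compares the two. -/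
theorem le_circleRadius_iff {x y z : E3} (hxy : x ≠ y) (hyz : y ≠ z) (hzx : z ≠ x) (d : ℝ≥0) :
    (d : ℝ≥0∞) ≤ circleRadius x y z ↔ ThreePoint d x y z := by
  unfold circleRadius
  simp only [le_iInf_iff, ENNReal.coe_le_coe]
  have hx : 0 < ‖x - z‖ ^ 2 := by have := norm_pos_iff.2 (sub_ne_zero.2 hzx.symm); positivity
  have hy : 0 < ‖y - z‖ ^ 2 := by have := norm_pos_iff.2 (sub_ne_zero.2 hyz); positivity
  have hz : 0 < ‖x - y‖ ^ 2 := by have := norm_pos_iff.2 (sub_ne_zero.2 hxy); positivity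
  have hpos : 0 < ‖x - z‖ ^ 2 * ‖y - z‖ ^ 2 * ‖x - y‖ ^ 2 := by positivity
  constructor
  · intro h
    rcases (gram_nonneg (x - z) (y - z)).eq_or_lt with h0 | h0
    · rw [ThreePoint, ← h0]; linarith
    · obtain ⟨r, hr⟩ := exists_onCircleOfRadius h0
      rw [ThreePoint, ← hr.formula]
      have : (d : ℝ) ≤ r := h r hr
      gcongr
  · intro h r hr
    rw [ThreePoint, ← hr.formula] at h
    rw [← hr.formula] at hpos
    have hg : 0 < gram (x - z) (y - z) := by
      rcases (gram_nonneg (x - z) (y - z)).eq_or_lt with h0 | h0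
      · rw [← h0] at hpos; simp at hpos
      · exact h0
    have h2 : (d : ℝ) ^ 2 ≤ (r : ℝ) ^ 2 := by
      have := le_of_mul_le_mul_right h hg
      linarith
    exact_mod_cast (sq_le_sq₀ d.2 r.2).1 h2

/-- The polynomial condition is trivial when two points coincide, so distinctness of the parameters
can be dropped. What remains is stable under limits. -/
theorem le_thickness_iff {γ : UnitAddCircle → E3} (hγ : Function.Injective γ) (d : ℝ≥0) :
    (d : ℝ≥0∞) ≤ thickness γ ↔ ∀ u v w, ThreePoint d (γ u) (γ v) (γ w) := by
  unfold thickness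
  simp only [le_iInf_iff]
  constructor
  · intro h u v w
    by_cases h1 : u = v
    · subst h1; simp [ThreePoint, gram_self]
    by_cases h2 : v = w
    · subst h2; simp [ThreePoint, gram]
    by_cases h3 : w = u
    · subst h3; simp [ThreePoint, gram]
    exact (le_circleRadius_iff (hγ.ne h1) (hγ.ne h2) (hγ.ne h3) d).1 (h u v w ⟨h1, h2, h3⟩)
  · rintro h u v w ⟨h1, h2, h3⟩
    exact (le_circleRadius_iff (hγ.ne h1) (hγ.ne h2) (hγ.ne h3) d).2 (h u v w)

theorem continuous_gram : Continuous fun p : E3 × E3 => gram p.1 p.2 := by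
  unfold gram; fun_prop

theorem ThreePoint.of_tendsto {ι : Type*} {l : Filter ι} [l.NeBot] {d : ℝ} {X Y Z : ι → E3}
    {x y z : E3} (hX : Filter.Tendsto X l (nhds x)) (hY : Filter.Tendsto Y l (nhds y))
    (hZ : Filter.Tendsto Z l (nhds z)) (h : ∀ᶠ i in l, ThreePoint d (X i) (Y i) (Z i)) :
    ThreePoint d x y z := by
  refine le_of_tendsto_of_tendsto ?_ ?_ h
  · exact ((continuous_gram.tendsto _).comp ((hX.sub hZ).prodMk_nhds (hY.sub hZ))).const_mul _
  · exact (((hX.sub hZ).norm.pow 2).mul ((hY.sub hZ).norm.pow 2)).mul ((hX.sub hY).norm.pow 2)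

/-- The limit of the three point condition as two of the points coalesce along a tangent. -/
theorem ThreePoint.tangent {γ : ℝ → E3} {t : ℝ} {τ x : E3} {d : ℝ} (hγ : HasDerivAt γ τ t)
    (h : ∀ s, ThreePoint d x (γ s) (γ t)) :
    4 * d ^ 2 * gram (x - γ t) τ ≤ ‖x - γ t‖ ^ 4 * ‖τ‖ ^ 2 := by
  have hslope := hγ.tendsto_slope
  have hc : Filter.Tendsto γ (nhdsWithin t {t}ᶜ) (nhds (γ t)) :=
    hγ.continuousAt.tendsto.mono_left nhdsWithin_le_nhds
  refine le_of_tendsto_of_tendsto (f := fun s => 4 * d ^ 2 * gram (x - γ t) (slope γ t s))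
    (g := fun s => ‖x - γ t‖ ^ 2 * ‖slope γ t s‖ ^ 2 * ‖x - γ s‖ ^ 2)
    (b := nhdsWithin t {t}ᶜ) ?_ ?_ ?_
  · exact ((continuous_gram.tendsto _).comp (tendsto_const_nhds.prodMk_nhds hslope)).const_mul _
  · have := (tendsto_const_nhds (x := ‖x - γ t‖ ^ 2)).mul (hslope.norm.pow 2) |>.mul
      ((tendsto_const_nhds (x := x)).sub hc |>.norm.pow 2)
    convert this using 2
    ring
  · filter_upwards [self_mem_nhdsWithin] with s hs
    have hst : s - t ≠ 0 := sub_ne_zero.2 hs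
    have h1 := h s
    unfold ThreePoint at h1
    simp only [slope_def_module, gram, norm_smul, inner_smul_right, norm_inv, Real.norm_eq_abs]
      at h1 ⊢
    simp only [mul_pow, inv_pow, sq_abs]
    -- Dividing by `(s - t)²` turns `γ s - γ t` into the difference quotient, since `gram` is
    -- quadratic in each argument.
    have h2 := mul_le_mul_of_nonneg_left h1 (inv_nonneg.2 (sq_nonneg (s - t)))
    calc _ = _ := ?_
      _ ≤ _ := h2
      _ = _ := ?_
    · ring
    · ring

/-! ### Ambient isotopies from Lipschitz displacements -/

/-- The map approximates the identity globally with Lipschitz error `K < 1`, so it is a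
homeomorphism of the whole space. -/
theorem exists_homeomorph_add_smul {f : E3 → E3} {K : ℝ≥0} (hf : LipschitzWith K f) (hK : K < 1)
    (s : I) : ∃ H : E3 ≃ₜ E3, ∀ x, H x = x + (s : ℝ) • f x := by
  have happ : ApproximatesLinearOn (fun x => x + (s : ℝ) • f x)
      ((ContinuousLinearEquiv.refl ℝ E3 : E3 ≃L[ℝ] E3) : E3 →L[ℝ] E3) univ K := by
    intro x _ y _
    have h1 : x + (s : ℝ) • f x - (y + (s : ℝ) • f y) - (x - y) = (s : ℝ) • (f x - f y) := by
      rw [smul_sub]; abel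
    simp only [ContinuousLinearEquiv.coe_refl, ContinuousLinearMap.coe_id', id_eq]
    rw [h1, norm_smul, Real.norm_of_nonneg s.2.1, ← dist_eq_norm, ← dist_eq_norm]
    exact (mul_le_of_le_one_left dist_nonneg s.2.2).trans (hf.dist_le_mul x y)
  refine ⟨happ.toHomeomorph _ (Or.inr ?_), fun x => rfl⟩
  have : ‖((ContinuousLinearEquiv.refl ℝ E3).symm : E3 →L[ℝ] E3)‖₊ = 1 := by
    simp only [ContinuousLinearEquiv.refl_symm, ContinuousLinearEquiv.coe_refl]
    exact ContinuousLinearMap.nnnorm_id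
  rw [this]
  simpa using hK

/-- By `h`, the displacement depends only on the point `P x` and is `κ`-Lipschitz on the trace. Its
extension `g` to space costs a factor `lipschitzExtensionConstant E3`, and `x ↦ x + s • g x` is the
isotopy. -/
theorem AmbientIsotopic.of_lipschitz {X : Type*} {P f : X → E3} {κ : ℝ≥0}
    (h : ∀ x y, ‖f x - f y‖ ≤ κ * ‖P x - P y‖) (hκ : lipschitzExtensionConstant E3 * κ < 1) :
    AmbientIsotopic (range P) (range (P + f)) := by
  classical
  set φ : E3 → E3 := fun p => if hp : p ∈ range P then f hp.choose else 0 with hφ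
  have hφP : ∀ x, φ (P x) = f x := by
    intro x
    have hp : P x ∈ range P := ⟨x, rfl⟩
    have h1 := h hp.choose x
    rw [hp.choose_spec, sub_self, norm_zero, mul_zero] at h1
    simp only [hφ, dif_pos hp]
    exact sub_eq_zero.1 (norm_le_zero_iff.1 h1)
  have hlip : LipschitzOnWith κ φ (range P) := by
    refine LipschitzOnWith.of_dist_le_mul ?_
    rintro _ ⟨x, rfl⟩ _ ⟨y, rfl⟩
    rw [hφP, hφP, dist_eq_norm, dist_eq_norm]
    exact h x y
  obtain ⟨g, hg, hgφ⟩ := hlip.extend_finite_dimension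
  choose H hH using fun s => exists_homeomorph_add_smul hg hκ s
  refine ⟨H, ?_, fun x => by simp [hH], ?_⟩
  · simp only [hH]
    have := hg.continuous
    fun_prop
  · rw [← range_comp]
    congr 1
    ext1 x
    simp [hH, ← hgφ (mem_range_self x), hφP]

/-- A linear homotopy of uniformly bi-Lipschitz curves is covered by an ambient isotopy. -/
theorem AmbientIsotopic.of_linear_homotopy {X : Type*} {P f : X → E3} {κ : ℝ}
    (h : ∀ s ∈ Icc (0 : ℝ) 1, ∀ x y, ‖f x - f y‖ ≤ κ * ‖(P x + s • f x) - (P y + s • f y)‖) :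
    AmbientIsotopic (range P) (range (P + f)) := by
  -- With `N` steps, each displacement `f / N` is `κ / N`-Lipschitz relative to the curve already
  -- reached, small enough for the extension to have constant below 1.
  obtain ⟨N, hN⟩ := exists_nat_gt ((lipschitzExtensionConstant E3 : ℝ) * κ.toNNReal)
  have hN0 : (0 : ℝ) < N := lt_of_le_of_lt (by positivity) hN
  have step : ∀ j : ℕ, j ≤ N →
      AmbientIsotopic (range P) (range (P + ((j : ℝ) / N) • f)) := by
    intro j
    induction j with
    | zero => intro _; simpa using AmbientIsotopic.refl _
    | succ j ih =>
      intro hj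
      refine (ih (by omega)).trans ?_
      have e : P + (((j + 1 : ℕ) : ℝ) / N) • f = (P + ((j : ℝ) / N) • f) + (1 / (N : ℝ)) • f := by
        push_cast
        rw [add_div, add_smul, add_assoc]
      rw [e]
      refine AmbientIsotopic.of_lipschitz (κ := κ.toNNReal / N) ?_ ?_
      · intro x y
        have h1 := h ((j : ℝ) / N) ⟨by positivity, (div_le_one hN0).2 (by
          exact_mod_cast (by omega : j ≤ N))⟩ x y
        simp only [Pi.add_apply, Pi.smul_apply]
        rw [← smul_sub, norm_smul, Real.norm_of_nonneg (by positivity), NNReal.coe_div,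
          NNReal.coe_natCast, div_mul_eq_mul_div, div_mul_eq_mul_div, one_mul]
        gcongr
        exact h1.trans (by gcongr; exact Real.le_coe_toNNReal κ)
      · rw [← NNReal.coe_lt_coe]
        push_cast
        rw [← mul_div_assoc, div_lt_one hN0]
        exact hN
  have := step N le_rfl
  rwa [div_self hN0.ne', one_smul] at this

/-! ### Weak derivatives on the circle -/

theorem ae_comp_coe {p : UnitAddCircle → Prop} (h : ∀ᵐ x, p x) (a : ℝ) :
    ∀ᵐ t : ℝ ∂(volume.restrict (Ioc a (a + 1))), p (t : UnitAddCircle) :=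
  (UnitAddCircle.measurePreserving_mk a).quasiMeasurePreserving.ae h

theorem intervalIntegrable_coe {f : UnitAddCircle → E3} (hf : Integrable f) :
    IntervalIntegrable (fun t : ℝ => f t) volume 0 1 := by
  rw [intervalIntegrable_iff_integrableOn_Ioc_of_le zero_le_one]
  have := (UnitAddCircle.measurePreserving_mk 0).integrable_comp_of_integrable hf
  rwa [zero_add] at this

theorem periodic_coe (f : UnitAddCircle → E3) : Function.Periodic (fun t : ℝ => f t) 1 := by
  intro t
  simp

theorem intervalIntegrable_coe' {f : UnitAddCircle → E3} (hf : Integrable f) (a b : ℝ) :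
    IntervalIntegrable (fun t : ℝ => f t) volume a b :=
  (periodic_coe f).intervalIntegrable₀ one_ne_zero (intervalIntegrable_coe hf) a b

theorem intervalIntegrable_smul_coe {f : UnitAddCircle → E3} (hf : Integrable f) {φ : ℝ → ℝ}
    (hφ : Continuous φ) : IntervalIntegrable (fun t : ℝ => φ t • f t) volume 0 1 :=
  (intervalIntegrable_coe hf).continuousOn_smul hφ.continuousOn

theorem integral_smul_congr_ae {f g : UnitAddCircle → E3} (h : f =ᵐ[volume] g) (φ : ℝ → ℝ) :
    ∫ t in (0 : ℝ)..1, φ t • f t = ∫ t in (0 : ℝ)..1, φ t • g t := by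
  rw [intervalIntegral.integral_of_le zero_le_one, intervalIntegral.integral_of_le zero_le_one]
  refine integral_congr_ae ?_
  have := ae_comp_coe h 0
  rw [zero_add] at this
  filter_upwards [this] with t ht
  rw [ht]

theorem HasWeakDeriv.congr_ae {f f' g g' : UnitAddCircle → E3} (h : HasWeakDeriv f g)
    (hf : f =ᵐ[volume] f') (hg : g =ᵐ[volume] g') : HasWeakDeriv f' g' := by
  intro φ h1 h2
  rw [← integral_smul_congr_ae hf, ← integral_smul_congr_ae hg]
  exact h φ h1 h2

/-- The `1`-periodic extension of a function supported in `(0, 1)` is smooth. -/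
theorem contDiff_comp_fract {g : ℝ → ℝ} (hg : ContDiff ℝ ∞ g)
    (hs : tsupport g ⊆ Ioo 0 1) : ContDiff ℝ ∞ (fun t => g (Int.fract t)) := by
  rw [contDiff_iff_contDiffAt]
  intro x
  set n := ⌊x⌋
  by_cases hx : x = n
  · have hopen : IsOpen (tsupport g)ᶜ := (isClosed_tsupport g).isOpen_compl
    have h0 : (0 : ℝ) ∈ (tsupport g)ᶜ := fun h => lt_irrefl _ (hs h).1
    have h1 : (1 : ℝ) ∈ (tsupport g)ᶜ := fun h => lt_irrefl _ (hs h).2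
    have e1 : ∀ᶠ t : ℝ in nhds x, t - n ∈ (tsupport g)ᶜ :=
      ((continuous_id.sub continuous_const).tendsto x).eventually
        (hopen.mem_nhds (by simpa [← hx] using h0))
    have e2 : ∀ᶠ t : ℝ in nhds x, t - n + 1 ∈ (tsupport g)ᶜ :=
      (((continuous_id.sub continuous_const).add continuous_const).tendsto x).eventually
        (hopen.mem_nhds (by simpa [← hx] using h1))
    have e3 : ∀ᶠ t : ℝ in nhds x, t ∈ Ioo (x - 1) (x + 1) := Ioo_mem_nhds (by linarith) (by linarith)
    refine (contDiffAt_const (c := (0 : ℝ))).congr_of_eventuallyEq ?_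
    filter_upwards [e1, e2, e3] with t t1 t2 t3
    rcases le_or_gt (n : ℝ) t with h | h
    · have : ⌊t⌋ = n := Int.floor_eq_iff.2 ⟨h, by rw [hx] at t3; exact t3.2⟩
      rw [Int.fract, this]
      exact image_eq_zero_of_notMem_tsupport t1
    · have : ⌊t⌋ = n - 1 := Int.floor_eq_iff.2 (by
        push_cast; exact ⟨by rw [hx] at t3; exact t3.1.le, by linarith⟩)
      rw [Int.fract, this]
      push_cast
      rw [show t - ((n : ℝ) - 1) = t - n + 1 by ring]
      exact image_eq_zero_of_notMem_tsupport t2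
  · have hlt : (n : ℝ) < x := lt_of_le_of_ne (Int.floor_le x) (Ne.symm hx)
    have e3 : ∀ᶠ t : ℝ in nhds x, t ∈ Ioo (n : ℝ) (n + 1) :=
      Ioo_mem_nhds hlt (Int.lt_floor_add_one x)
    refine ((hg.comp (contDiff_id.sub (contDiff_const (c := (n : ℝ))))).contDiffAt).congr_of_eventuallyEq ?_
    filter_upwards [e3] with t ht
    have : ⌊t⌋ = n := Int.floor_eq_iff.2 ⟨ht.1.le, ht.2⟩
    simp [Int.fract, this]

/-- Bump functions supported in `(0, 1)` have smooth periodic extensions, so the fundamental lemma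
of the calculus of variations applies on the open interval; the endpoint is a null set. -/
theorem ae_eq_zero_of_integral_periodic_smul {f : UnitAddCircle → E3} (hf : Integrable f)
    (h : ∀ φ : ℝ → ℝ, ContDiff ℝ ∞ φ → Function.Periodic φ 1 →
      ∫ t in (0 : ℝ)..1, φ t • f t = 0) : f =ᵐ[volume] 0 := by
  have hI : IntegrableOn (fun t : ℝ => f t) (Ioc 0 1) :=
    (intervalIntegrable_iff_integrableOn_Ioc_of_le zero_le_one).1 (intervalIntegrable_coe hf)
  have key : ∀ᵐ x : ℝ, x ∈ Ioo (0 : ℝ) 1 → f x = 0 := by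
    refine isOpen_Ioo.ae_eq_zero_of_integral_contDiff_smul_eq_zero
      (hI.mono_set Ioo_subset_Ioc_self).locallyIntegrableOn ?_
    intro g hg _ hs
    have h1 := h (fun t => g (Int.fract t)) (contDiff_comp_fract hg hs)
      (fun t => by simp only [Int.fract_add_one])
    rw [intervalIntegral.integral_of_le zero_le_one, integral_Ioc_eq_integral_Ioo] at h1
    rw [← h1, ← setIntegral_eq_integral_of_forall_compl_eq_zero (s := Ioo (0 : ℝ) 1)]
    · refine setIntegral_congr_fun measurableSet_Ioo fun t ht => ?_
      simp only [Int.fract_eq_self.2 ⟨ht.1.le, ht.2⟩]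
    · intro x hx
      rw [image_eq_zero_of_notMem_tsupport (fun h => hx (hs h)), zero_smul]
  have h2 : ∫⁻ x : UnitAddCircle, ‖f x‖ₑ = 0 := by
    rw [← UnitAddCircle.lintegral_preimage 0, zero_add, setLIntegral_congr Ioo_ae_eq_Ioc.symm]
    rw [setLIntegral_congr_fun_ae measurableSet_Ioo (g := fun _ => 0)]
    · simp
    · filter_upwards [key] with x hx hx2
      simp [hx hx2]
  rw [lintegral_eq_zero_iff' hf.1.enorm] at h2
  filter_upwards [h2] with x hx
  simpa using hx

theorem HasWeakDeriv.ae_unique {f g g' : UnitAddCircle → E3} (hg : Integrable g)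
    (hg' : Integrable g') (h : HasWeakDeriv f g) (h' : HasWeakDeriv f g') : g =ᵐ[volume] g' := by
  have := ae_eq_zero_of_integral_periodic_smul (hg.sub hg') (fun φ h1 h2 => by
    simp only [Pi.sub_apply, smul_sub]
    rw [intervalIntegral.integral_sub (intervalIntegrable_smul_coe hg h1.continuous)
      (intervalIntegrable_smul_coe hg' h1.continuous)]
    have e1 := h φ h1 h2
    have e2 := h' φ h1 h2
    rw [e1] at e2
    rw [neg_injective e2, sub_self])
  filter_upwards [this] with x hx
  exact sub_eq_zero.1 hx

/-- Du Bois-Reymond: a function with vanishing weak derivative is constant. -/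
theorem ae_eq_const_of_integral_deriv_smul {f : UnitAddCircle → E3} (hf : Integrable f)
    (h : ∀ φ : ℝ → ℝ, ContDiff ℝ ∞ φ → Function.Periodic φ 1 →
      ∫ t in (0 : ℝ)..1, deriv φ t • f t = 0) : ∃ c : E3, f =ᵐ[volume] fun _ => c := by
  set c := ∫ t in (0 : ℝ)..1, f t with hc
  have hcI : Integrable (fun _ : UnitAddCircle => c) := integrable_const c
  refine ⟨c, ?_⟩
  have := ae_eq_zero_of_integral_periodic_smul (hf.sub hcI) (fun ψ h1 h2 => by
    -- Subtracting the mean of `ψ` makes its primitive `φ` periodic, hence admissible as a test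
    -- function.
    set m := ∫ t in (0 : ℝ)..1, ψ t with hm
    set φ : ℝ → ℝ := fun t => ∫ s in (0 : ℝ)..t, (ψ s - m) with hφ
    have hcont : Continuous fun s => ψ s - m := h1.continuous.sub continuous_const
    have hder : ∀ t, HasDerivAt φ (ψ t - m) t := fun t =>
      intervalIntegral.integral_hasDerivAt_right (hcont.intervalIntegrable _ _)
        hcont.stronglyMeasurable.stronglyMeasurableAtFilter hcont.continuousAt
    have hderiv : deriv φ = fun t => ψ t - m := funext fun t => (hder t).deriv
    have hsm : ContDiff ℝ ∞ φ := by
      rw [contDiff_infty_iff_deriv, hderiv]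
      exact ⟨fun t => (hder t).differentiableAt, h1.sub contDiff_const⟩
    have hper : Function.Periodic φ 1 := by
      intro t
      have hp : Function.Periodic (fun s => ψ s - m) 1 := fun s => by simp [h2 s]
      have e1 := intervalIntegral.integral_add_adjacent_intervals
        (hcont.intervalIntegrable (μ := volume) 0 t) (hcont.intervalIntegrable t (t + 1))
      have e0 : ∫ s in (0 : ℝ)..1, (ψ s - m) = 0 := by
        rw [intervalIntegral.integral_sub (h1.continuous.intervalIntegrable _ _) (by simp), ← hm]
        simp
      rw [hp.intervalIntegral_add_eq t 0, zero_add, e0, add_zero] at e1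
      exact e1.symm
    have e := h φ hsm hper
    rw [hderiv] at e
    simp only [Pi.sub_apply, smul_sub, sub_smul] at e ⊢
    rw [intervalIntegral.integral_sub (intervalIntegrable_smul_coe hf h1.continuous)
      (intervalIntegrable_smul_coe hf continuous_const), intervalIntegral.integral_smul, ← hc] at e
    rw [intervalIntegral.integral_sub (intervalIntegrable_smul_coe hf h1.continuous)
      (intervalIntegrable_smul_coe hcI h1.continuous), intervalIntegral.integral_smul_const, ← hm]
    exact e)
  filter_upwards [this] with x hx
  exact sub_eq_zero.1 hx

theorem intervalIntegral_coord {F : ℝ → E3} (hF : IntervalIntegrable F volume 0 1) (i : Fin 3) :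
    (∫ t in (0 : ℝ)..1, F t) i = ∫ t in (0 : ℝ)..1, F t i :=
  ((EuclideanSpace.proj i : E3 →L[ℝ] ℝ).intervalIntegral_comp_comm hF).symm

theorem continuous_coe_lift {f : ℝ → E3} (hf : Continuous f) (hp : Function.Periodic f 1) :
    Continuous (hp.lift : UnitAddCircle → E3) :=
  (QuotientAddGroup.isQuotientMap_mk (N := AddSubgroup.zmultiples (1 : ℝ))).continuous_iff.2 hf

/-- Integration by parts for a primitive of an integrable function. -/
theorem HasWeakDeriv.of_primitive {F g : UnitAddCircle → E3} (hg : Integrable g) {c : E3}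
    (h0 : ∫ t in (0 : ℝ)..1, g t = 0) (hF : ∀ t : ℝ, F t = c + ∫ s in (0 : ℝ)..t, g s) :
    HasWeakDeriv F g := by
  intro φ hφ hper
  have hI := intervalIntegrable_coe hg
  have hφd : Continuous (deriv φ) := (contDiff_infty_iff_deriv.1 hφ).2.continuous
  have hprim : Continuous fun t : ℝ => ∫ s in (0 : ℝ)..t, g s :=
    intervalIntegral.continuous_primitive (fun a b => intervalIntegrable_coe' hg a b) 0
  have hφ01 : φ 1 = φ 0 := by have := hper 0; rwa [zero_add] at this
  have e1 : ∫ t in (0 : ℝ)..1, deriv φ t • F t =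
      ∫ t in (0 : ℝ)..1, deriv φ t • ∫ s in (0 : ℝ)..t, g s := by
    simp only [hF, smul_add]
    rw [intervalIntegral.integral_add, intervalIntegral.integral_smul_const,
      intervalIntegral.integral_deriv_eq_sub (fun x _ => (hφ.differentiable (by simp)) x)
        (hφd.intervalIntegrable _ _), hφ01, sub_self, zero_smul, zero_add]
    · exact (hφd.smul continuous_const).intervalIntegrable _ _
    · exact (hφd.smul hprim).intervalIntegrable _ _
  rw [e1]
  -- In each coordinate both factors are absolutely continuous. The boundary terms vanish because
  -- the primitive of `g` is zero at 0 and at 1.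
  ext i
  have hIi : IntervalIntegrable (fun t : ℝ => g t i) volume 0 1 :=
    ⟨(EuclideanSpace.proj i : E3 →L[ℝ] ℝ).integrable_comp hI.1,
      (EuclideanSpace.proj i : E3 →L[ℝ] ℝ).integrable_comp hI.2⟩
  rw [PiLp.neg_apply, intervalIntegral_coord (F := fun t => deriv φ t • ∫ s in (0 : ℝ)..t, g s)
      ((hφd.smul hprim).intervalIntegrable _ _),
    intervalIntegral_coord (intervalIntegrable_smul_coe hg hφ.continuous)]
  simp only [PiLp.smul_apply, smul_eq_mul]
  have hac := hIi.absolutelyContinuousOnInterval_intervalIntegral (c := 0) (by simp)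
  have hacφ : AbsolutelyContinuousOnInterval φ 0 1 :=
    ContDiffOn.absolutelyContinuousOnInterval (hφ.of_le (by simp)).contDiffOn
  have hibp := hacφ.integral_mul_deriv_eq_deriv_mul hac
  have h1 : ∫ s in (0 : ℝ)..1, g s i = 0 := by rw [← intervalIntegral_coord hI, h0]; rfl
  simp only [h1, intervalIntegral.integral_same, mul_zero, sub_self, zero_sub] at hibp
  have e2 : ∫ x in (0 : ℝ)..1, φ x * deriv (fun x : ℝ => ∫ s in (0 : ℝ)..x, g s i) x =
      ∫ x in (0 : ℝ)..1, φ x * g x i := by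
    apply intervalIntegral.integral_congr_ae
    filter_upwards [hIi.ae_hasDerivAt_integral] with x hx hx2
    rw [(hx (uIoc_subset_uIcc hx2) 0 (by simp)).deriv]
  rw [e2] at hibp
  rw [hibp, neg_neg]
  apply intervalIntegral.integral_congr
  intro t ht
  rw [uIcc_of_le zero_le_one] at ht
  have : (∫ s in (0 : ℝ)..t, g s) i = ∫ s in (0 : ℝ)..t, g s i :=
    ((EuclideanSpace.proj i : E3 →L[ℝ] ℝ).intervalIntegral_comp_comm
      (intervalIntegrable_coe' hg 0 t)).symm
  simp only [this]

theorem HasWeakDeriv.integral_eq_zero {f g : UnitAddCircle → E3} (h : HasWeakDeriv f g) :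
    ∫ t in (0 : ℝ)..1, g t = 0 := by
  have := h (fun _ => 1) contDiff_const (fun _ => rfl)
  simpa using this.symm

/-- A function with an integrable weak derivative agrees almost everywhere with a primitive. -/
theorem HasWeakDeriv.exists_primitive {f g : UnitAddCircle → E3} (hf : Integrable f)
    (hg : Integrable g) (h : HasWeakDeriv f g) :
    ∃ F : UnitAddCircle → E3, Continuous F ∧ F =ᵐ[volume] f ∧
      ∃ c : E3, ∀ t : ℝ, F t = c + ∫ s in (0 : ℝ)..t, g s := by
  set G : ℝ → E3 := fun t => ∫ s in (0 : ℝ)..t, g s with hG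
  have hprim : Continuous G :=
    intervalIntegral.continuous_primitive (fun a b => intervalIntegrable_coe' hg a b) 0
  have hper : Function.Periodic G 1 := by
    intro t
    have e1 := intervalIntegral.integral_add_adjacent_intervals
        (intervalIntegrable_coe' hg 0 t) (intervalIntegrable_coe' hg t (t + 1))
    rw [(periodic_coe g).intervalIntegral_add_eq t 0, zero_add, h.integral_eq_zero, add_zero] at e1
    exact e1.symm
  set L : UnitAddCircle → E3 := hper.lift with hL
  have hLc : Continuous L := continuous_coe_lift hprim hper
  have hLt : ∀ t : ℝ, L t = G t := fun t => rfl
  have hLw : HasWeakDeriv L g := HasWeakDeriv.of_primitive hg (c := 0) h.integral_eq_zero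
    (fun t => by rw [hLt, zero_add])
  have hLI : Integrable L := hLc.integrable_of_hasCompactSupport (HasCompactSupport.of_compactSpace _)
  obtain ⟨c, hc⟩ := ae_eq_const_of_integral_deriv_smul (hf.sub hLI) (fun φ h1 h2 => by
    have hφd : Continuous (deriv φ) := (contDiff_infty_iff_deriv.1 h1).2.continuous
    simp only [Pi.sub_apply, smul_sub]
    rw [intervalIntegral.integral_sub (intervalIntegrable_smul_coe hf hφd)
      (intervalIntegrable_smul_coe hLI hφd), h φ h1 h2, hLw φ h1 h2, sub_self])
  refine ⟨fun x => c + L x, continuous_const.add hLc, ?_, c, fun t => rfl⟩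
  filter_upwards [hc] with x hx
  rw [← hx]
  simp

theorem _root_.MeasureTheory.MemLp.integrable_circle {f : UnitAddCircle → E3} (hf : MemLp f 2) :
    Integrable f := hf.integrable (by norm_num)

theorem integrable_of_continuous {f : UnitAddCircle → E3} (hf : Continuous f) : Integrable f :=
  hf.integrable_of_hasCompactSupport (HasCompactSupport.of_compactSpace _)

theorem memLp_of_continuous {f : UnitAddCircle → E3} (hf : Continuous f) : MemLp f 2 :=
  hf.memLp_of_hasCompactSupport (HasCompactSupport.of_compactSpace _)

theorem weakDeriv_ae_eq {f g : UnitAddCircle → E3} (hg : MemLp g 2) (h : HasWeakDeriv f g) :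
    weakDeriv f =ᵐ[volume] g := by
  have hex : ∃ g : UnitAddCircle → E3, MemLp g 2 volume ∧ HasWeakDeriv f g := ⟨g, hg, h⟩
  rw [weakDeriv, dif_pos hex]
  exact hex.choose_spec.2.ae_unique hex.choose_spec.1.integrable_circle hg.integrable_circle h

theorem bendingEnergy_eq {γ W g : UnitAddCircle → E3} (hW : MemLp W 2) (hg : MemLp g 2)
    (h1 : HasWeakDeriv γ W) (h2 : HasWeakDeriv W g) :
    bendingEnergy γ = ∫⁻ t, ‖g t‖ₑ ^ 2 := by
  have e1 := weakDeriv_ae_eq hW h1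
  have e2 := weakDeriv_ae_eq hg (h2.congr_ae e1.symm Filter.EventuallyEq.rfl)
  refine lintegral_congr_ae ?_
  filter_upwards [e2] with t ht
  rw [ht]

/-- `W` and `g` are the continuous first and the square integrable second derivative of the
arclength parametrised curve `γ`. -/
structure UnitSpeedH2 (γ W g : UnitAddCircle → E3) : Prop where
  cont : Continuous γ
  contW : Continuous W
  memLp : MemLp g 2
  hasDerivAt : ∀ t : ℝ, HasDerivAt (fun s : ℝ => γ s) (W t) t
  norm_eq : ∀ x, ‖W x‖ = 1
  weak : HasWeakDeriv W g
  primitive : ∃ c : E3, ∀ t : ℝ, W t = c + ∫ s in (0 : ℝ)..t, g s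

/-- The first weak derivative has a continuous representative `W`, and `γ`, being continuous, equals
a primitive of `W` everywhere. So `W` is the classical derivative and inherits unit norm. -/
theorem exists_unitSpeedH2 {γ : UnitAddCircle → E3} (hγ : MemH2 γ)
    (hv : ∀ t : ℝ, ‖velocity γ t‖ = 1) : ∃ W g, UnitSpeedH2 γ W g := by
  obtain ⟨hc, -, g₁, g₂, h1, h2, hw1, hw2⟩ := hγ
  obtain ⟨W, hWc, hWg, hprim⟩ := hw2.exists_primitive h1.integrable_circle h2.integrable_circle
  have hγW : HasWeakDeriv γ W := hw1.congr_ae Filter.EventuallyEq.rfl hWg.symm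
  obtain ⟨F, hFc, hFγ, c, hF⟩ := hγW.exists_primitive (integrable_of_continuous hc)
    (integrable_of_continuous hWc)
  have hFe : F = γ := (hFc.ae_eq_iff_eq volume hc).1 hFγ
  subst hFe
  have hWr : Continuous fun t : ℝ => W t := hWc.comp (AddCircle.continuous_mk' 1)
  have hder : ∀ t : ℝ, HasDerivAt (fun s : ℝ => F s) (W t) t := by
    intro t
    have := (intervalIntegral.integral_hasDerivAt_right (hWr.intervalIntegrable 0 t)
        hWr.stronglyMeasurable.stronglyMeasurableAtFilter hWr.continuousAt).const_add c
    exact this.congr_of_eventuallyEq (Filter.Eventually.of_forall hF)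
  refine ⟨W, g₂, hc, hWc, h2, hder, ?_, hw2.congr_ae hWg.symm Filter.EventuallyEq.rfl, hprim⟩
  intro x
  obtain ⟨t, rfl⟩ := QuotientAddGroup.mk_surjective x
  have := hv t
  rwa [velocity, (hder t).deriv] at this

namespace UnitSpeedH2

variable {γ W g : UnitAddCircle → E3}

theorem weak_left (h : UnitSpeedH2 γ W g) : HasWeakDeriv γ W := by
  have hWr : Continuous fun t : ℝ => W t := h.contW.comp (AddCircle.continuous_mk' 1)
  have e : ∀ t : ℝ, ∫ s in (0 : ℝ)..t, W s = γ t - γ (0 : ℝ) := fun t =>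
    intervalIntegral.integral_eq_sub_of_hasDerivAt (fun s _ => h.hasDerivAt s)
      (hWr.intervalIntegrable _ _)
  refine HasWeakDeriv.of_primitive (integrable_of_continuous h.contW) (c := γ (0 : ℝ)) ?_ ?_
  · rw [e]
    have := periodic_coe γ 0
    simp only [zero_add] at this
    rw [this, sub_self]
  · intro t
    rw [e]
    abel

theorem memH2 (h : UnitSpeedH2 γ W g) : MemH2 γ :=
  ⟨h.cont, memLp_of_continuous h.cont, W, g, memLp_of_continuous h.contW, h.memLp, h.weak_left,
    h.weak⟩

theorem bendingEnergy_eq (h : UnitSpeedH2 γ W g) : bendingEnergy γ = ∫⁻ t, ‖g t‖ₑ ^ 2 :=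
  SpringyKnots.bendingEnergy_eq (memLp_of_continuous h.contW) h.memLp h.weak_left h.weak

theorem velocity_eq (h : UnitSpeedH2 γ W g) (t : ℝ) : velocity γ t = W t :=
  (h.hasDerivAt t).deriv

theorem norm_velocity (h : UnitSpeedH2 γ W g) (t : ℝ) : ‖velocity γ t‖ = 1 := by
  rw [h.velocity_eq, h.norm_eq]

theorem length_eq (h : UnitSpeedH2 γ W g) : length γ = 1 := by
  have : ∀ t : ℝ, ‖velocity γ t‖ₑ = 1 := fun t => by
    rw [← ofReal_norm, h.norm_velocity, ENNReal.ofReal_one]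
  simp [length, this]

end UnitSpeedH2

/-! ### Quantitative embeddedness of thick loops -/

theorem exists_coe_eq_abs_eq (x : UnitAddCircle) : ∃ r : ℝ, (r : UnitAddCircle) = x ∧ |r| = ‖x‖ := by
  obtain ⟨t, rfl⟩ := QuotientAddGroup.mk_surjective x
  refine ⟨t - round t, ?_, ?_⟩
  · have : ((round t : ℝ) : UnitAddCircle) = 0 :=
      AddCircle.coe_eq_zero_iff (1 : ℝ) |>.2 ⟨round t, by simp⟩
    rw [AddCircle.coe_sub, this, sub_zero]
  · exact UnitAddCircle.norm_eq.symm

theorem norm_coe_le_abs (t : ℝ) : ‖(t : UnitAddCircle)‖ ≤ |t| := by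
  rw [UnitAddCircle.norm_eq]
  simpa using round_le t 0

theorem norm_circle_le_half (x : UnitAddCircle) : ‖x‖ ≤ 1 / 2 := by
  simpa using AddCircle.norm_le_half_period (1 : ℝ) (x := x) one_ne_zero

/-- Two points of the circle have lifts realising their distance. -/
theorem exists_lifts (x y : UnitAddCircle) :
    ∃ s t : ℝ, (s : UnitAddCircle) = x ∧ (t : UnitAddCircle) = y ∧ |t - s| = ‖y - x‖ := by
  obtain ⟨s, rfl⟩ := QuotientAddGroup.mk_surjective x
  obtain ⟨r, hr, hr2⟩ := exists_coe_eq_abs_eq (y - QuotientAddGroup.mk s)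
  refine ⟨s, s + r, rfl, ?_, by simpa using hr2⟩
  rw [AddCircle.coe_add, hr]
  exact add_sub_cancel _ _

/-- Cauchy–Schwarz for the integral of `g` over an interval no longer than a period. -/
theorem UnitSpeedH2.holder {γ W g : UnitAddCircle → E3} (h : UnitSpeedH2 γ W g) {B : ℝ}
    (hB0 : 0 ≤ B) (hB : ∫⁻ x, ‖g x‖ₑ ^ 2 ≤ ENNReal.ofReal (B ^ 2)) {s t : ℝ} (hst : s ≤ t)
    (hst1 : t ≤ s + 1) : ‖W t - W s‖ ≤ B * √(t - s) := by
  obtain ⟨c, hc⟩ := h.primitive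
  have hI := intervalIntegrable_coe' h.memLp.integrable_circle
  have e1 : W t - W s = ∫ u in s..t, g u := by
    rw [hc, hc, add_sub_add_left_eq_sub]
    exact intervalIntegral.integral_interval_sub_left (hI 0 t) (hI 0 s)
  have hmeas : AEMeasurable (fun u : ℝ => ‖g u‖ₑ) (volume.restrict (Ioc s t)) :=
    (hI s t).1.aestronglyMeasurable.enorm
  have e2 : ‖W t - W s‖ₑ ≤ ENNReal.ofReal (B * √(t - s)) := by
    rw [e1, intervalIntegral.integral_of_le hst]
    refine (enorm_integral_le_lintegral_enorm _).trans ?_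
    have h1 := ENNReal.lintegral_mul_le_Lp_mul_Lq (volume.restrict (Ioc s t))
      Real.HolderConjugate.two_two hmeas (aemeasurable_const (b := (1 : ℝ≥0∞)))
    have h2 : ∫⁻ u in Ioc s t, ‖g u‖ₑ ^ (2 : ℝ) ≤ ENNReal.ofReal (B ^ 2) := by
      refine le_trans ?_ hB
      rw [← UnitAddCircle.lintegral_preimage s]
      simp only [ENNReal.rpow_two]
      exact lintegral_mono_set (Ioc_subset_Ioc_right hst1)
    simp only [Pi.mul_def, mul_one, ENNReal.one_rpow, lintegral_const, Measure.restrict_apply,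
      MeasurableSet.univ, univ_inter, Real.volume_Ioc, one_mul] at h1
    refine h1.trans ?_
    rw [ENNReal.ofReal_mul hB0]
    gcongr
    · calc (∫⁻ u in Ioc s t, ‖g u‖ₑ ^ (2 : ℝ)) ^ (1 / 2 : ℝ)
          ≤ (ENNReal.ofReal (B ^ 2)) ^ (1 / 2 : ℝ) := by gcongr
        _ = ENNReal.ofReal B := by
            rw [ENNReal.ofReal_rpow_of_nonneg (by positivity) (by norm_num), ← Real.sqrt_eq_rpow,
              Real.sqrt_sq hB0]
    · rw [ENNReal.ofReal_rpow_of_nonneg (by linarith) (by norm_num), ← Real.sqrt_eq_rpow]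
  rw [← ofReal_norm] at e2
  exact (ENNReal.ofReal_le_ofReal_iff (by positivity)).1 e2

theorem UnitSpeedH2.holder_circle {γ W g : UnitAddCircle → E3} (h : UnitSpeedH2 γ W g) {B : ℝ}
    (hB0 : 0 ≤ B) (hB : ∫⁻ x, ‖g x‖ₑ ^ 2 ≤ ENNReal.ofReal (B ^ 2)) (x y : UnitAddCircle) :
    ‖W x - W y‖ ≤ B * √‖x - y‖ := by
  obtain ⟨s, t, rfl, rfl, hst⟩ := exists_lifts x y
  rw [norm_sub_rev (s : UnitAddCircle), ← hst]
  have hle : |t - s| ≤ 1 / 2 := hst ▸ norm_circle_le_half _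
  rcases le_total s t with h1 | h1
  · rw [abs_of_nonneg (by linarith)] at hle ⊢
    rw [norm_sub_rev]
    exact h.holder hB0 hB h1 (by linarith)
  · rw [abs_of_nonpos (by linarith)] at hle ⊢
    rw [neg_sub]
    exact h.holder hB0 hB h1 (by linarith)

/-- Within distance `δ` the unit tangent changes by at most 1/2, so the chord differs from the
straight segment `(t - s) • W s` by at most half its length. -/
theorem UnitSpeedH2.near {γ W g : UnitAddCircle → E3} (h : UnitSpeedH2 γ W g) {B δ : ℝ}
    (hB0 : 0 ≤ B) (hB : ∀ x y, ‖W x - W y‖ ≤ B * √‖x - y‖) (hδ : B * √δ ≤ 1 / 2)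
    {x y : UnitAddCircle} (hxy : ‖x - y‖ ≤ δ) : ‖x - y‖ / 2 ≤ ‖γ x - γ y‖ := by
  obtain ⟨s, t, rfl, rfl, hst⟩ := exists_lifts x y
  rw [norm_sub_rev, ← hst] at hxy ⊢
  have hd : ∀ u ∈ uIcc s t, HasDerivWithinAt (fun u : ℝ => γ u - (u - s) • W s) (W u - W s)
      (uIcc s t) u := by
    intro u _
    refine ((h.hasDerivAt u).sub ?_).hasDerivWithinAt
    simpa using ((hasDerivAt_id u).sub_const s).smul_const (W (s : UnitAddCircle))
  have hb : ∀ u ∈ uIcc s t, ‖W u - W s‖ ≤ 1 / 2 := by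
    intro u hu
    refine (hB _ _).trans (le_trans ?_ hδ)
    gcongr
    rw [← AddCircle.coe_sub]
    refine (norm_coe_le_abs _).trans (le_trans ?_ hxy)
    exact abs_sub_left_of_mem_uIcc hu
  have key := (convex_uIcc s t).norm_image_sub_le_of_norm_hasDerivWithin_le hd hb
    left_mem_uIcc right_mem_uIcc
  simp only [sub_self, zero_smul, sub_zero] at key
  have e : γ t - (t - s) • W s - γ s = (γ t - γ s) - (t - s) • W s := by abel
  rw [e, Real.norm_eq_abs] at key
  have h2 : ‖(t - s) • W (s : UnitAddCircle)‖ = |t - s| := by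
    rw [norm_smul, h.norm_eq, mul_one, Real.norm_eq_abs]
  have h3 := norm_sub_norm_le ((t - s) • W (s : UnitAddCircle)) (γ t - γ s)
  rw [norm_sub_rev ((t - s) • W (s : UnitAddCircle)), h2] at h3
  rw [norm_sub_rev (γ s)]
  linarith

/-- Fix `y` and minimize the chord over points at distance at least `δ`. If the minimizer is at
distance exactly `δ`, the near estimate gives `δ / 2`; otherwise the chord is orthogonal to the
tangent and thickness gives `2 * d`. As distances on the circle are at most 1/2, this yields the
factor `min δ (4 * d)`. -/
theorem UnitSpeedH2.lower_bound {γ W g : UnitAddCircle → E3} (h : UnitSpeedH2 γ W g)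
    (hinj : Function.Injective γ) {B δ d : ℝ} (hB0 : 0 ≤ B)
    (hB : ∀ x y, ‖W x - W y‖ ≤ B * √‖x - y‖) (hδ0 : 0 < δ) (hδ1 : δ ≤ 1 / 2)
    (hδ : B * √δ ≤ 1 / 2) (hd : 0 < d) (hT : ∀ u v w, ThreePoint d (γ u) (γ v) (γ w))
    (x y : UnitAddCircle) : min δ (4 * d) * ‖x - y‖ ≤ ‖γ x - γ y‖ := by
  rcases le_or_gt ‖x - y‖ δ with hxy | hxy
  · refine le_trans ?_ (h.near hB0 hB hδ hxy)
    rw [div_eq_inv_mul]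
    gcongr
    exact (min_le_left _ _).trans (hδ1.trans (by norm_num))
  · set S : Set UnitAddCircle := {z | δ ≤ ‖z - y‖} with hS
    have hSc : IsCompact S :=
      (isClosed_le continuous_const (continuous_id.sub continuous_const).norm).isCompact
    obtain ⟨z, hz, hmin⟩ := hSc.exists_isMinOn ⟨x, hxy.le⟩
      (f := fun z => ‖γ z - γ y‖) (h.cont.sub continuous_const).norm.continuousOn
    have hzx : ‖γ z - γ y‖ ≤ ‖γ x - γ y‖ := hmin hxy.le
    have hm : min δ (4 * d) * (1 / 2) ≤ ‖γ z - γ y‖ := by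
      rcases (show δ ≤ ‖z - y‖ from hz).eq_or_lt with hz1 | hz1
      · have := h.near hB0 hB hδ hz1.symm.le
        rw [← hz1] at this
        linarith [min_le_left δ (4 * d)]
      · obtain ⟨t, rfl⟩ := QuotientAddGroup.mk_surjective z
        change δ < ‖(t : UnitAddCircle) - y‖ at hz1
        have hnhds : ∀ᶠ s : ℝ in nhds t, δ < ‖(s : UnitAddCircle) - y‖ := by
          have hc : Continuous fun s : ℝ => ‖(s : UnitAddCircle) - y‖ :=
            ((AddCircle.continuous_mk' (1 : ℝ)).sub continuous_const).norm
          exact (hc.tendsto t).eventually (lt_mem_nhds hz1)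
        have hloc : IsLocalMin (fun s : ℝ => ‖γ s - γ y‖ ^ 2) t := by
          filter_upwards [hnhds] with s hs
          have : ‖γ (t : UnitAddCircle) - γ y‖ ≤ ‖γ (s : UnitAddCircle) - γ y‖ := hmin hs.le
          gcongr
        have hder := hloc.hasDerivAt_eq_zero (((h.hasDerivAt t).sub_const (γ y)).norm_sq)
        have horth : inner ℝ (γ y - γ t) (W t) = 0 := by
          rw [← neg_sub, inner_neg_left]
          linarith
        -- For a chord of length `ℓ` orthogonal to the unit tangent this reads `4 d² ℓ² ≤ ℓ⁴`: the
        -- tangent circle has the chord as its diameter.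
        have htan := ThreePoint.tangent (h.hasDerivAt t) (x := γ y) (d := d) (fun s => hT _ _ _)
        rw [gram, horth, h.norm_eq, norm_sub_rev] at htan
        have hne : (t : UnitAddCircle) ≠ y := by
          intro he
          rw [he, sub_self, norm_zero] at hz1
          linarith
        have hpos : 0 < ‖γ t - γ y‖ := norm_pos_iff.2 (sub_ne_zero.2 (hinj.ne hne))
        have h4 : (2 * d) ^ 2 ≤ ‖γ t - γ y‖ ^ 2 := by
          have : (2 * d) ^ 2 * ‖γ t - γ y‖ ^ 2 ≤ ‖γ t - γ y‖ ^ 2 * ‖γ t - γ y‖ ^ 2 := by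
            nlinarith
          exact le_of_mul_le_mul_right this (by positivity)
        have h5 := (sq_le_sq₀ (by linarith) hpos.le).1 h4
        linarith [min_le_right δ (4 * d)]
    refine le_trans ?_ (hm.trans hzx)
    exact mul_le_mul_of_nonneg_left (norm_circle_le_half _) (le_min hδ0.le (by linarith))

/-! ### Weak limits of second derivatives -/

-- Banach–Alaoglu through the Riesz isomorphism; an ultrafilter replaces the extraction of a
-- subsequence.
open Filter Topology in
theorem exists_weak_limit {H : Type*} [NormedAddCommGroup H] [InnerProductSpace ℝ H]
    [CompleteSpace H] (l : Ultrafilter ℕ) (u : ℕ → H) {M : ℝ} (hu : ∀ n, ‖u n‖ ≤ M) :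
    ∃ v : H, ∀ w : H, Tendsto (fun n => inner ℝ (u n) w) l (𝓝 (inner ℝ v w)) := by
  have hK := WeakDual.isCompact_closedBall (𝕜 := ℝ) (0 : StrongDual ℝ H) M
  obtain ⟨x, -, hx⟩ := hK.ultrafilter_le_nhds
    (l.map fun n => StrongDual.toWeakDual (InnerProductSpace.toDual ℝ H (u n))) (by
      rw [Filter.le_principal_iff, Ultrafilter.mem_coe, Ultrafilter.mem_map]
      refine Filter.univ_mem' fun n => ?_
      simpa using hu n)
  refine ⟨(InnerProductSpace.toDual ℝ H).symm (WeakDual.toStrongDual x), fun w => ?_⟩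
  have h1 := ((WeakDual.eval_continuous w).tendsto x).mono_left hx
  rw [InnerProductSpace.toDual_symm_apply]
  rw [Ultrafilter.coe_map, Filter.tendsto_map'_iff] at h1
  exact h1

theorem lintegral_enorm_sq_eq {g : UnitAddCircle → E3} (hg : MemLp g 2) :
    ∫⁻ x, ‖g x‖ₑ ^ 2 = ENNReal.ofReal (‖hg.toLp g‖ ^ 2) := by
  have h1 : eLpNorm g 2 volume ^ 2 = ∫⁻ x, ‖g x‖ₑ ^ 2 := by
    rw [eLpNorm_eq_lintegral_rpow_enorm_toReal (by norm_num) (by norm_num)]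
    simp only [ENNReal.toReal_ofNat, ENNReal.rpow_two]
    rw [← ENNReal.rpow_two, ← ENNReal.rpow_mul]
    norm_num
  rw [Lp.norm_toLp, ← ENNReal.toReal_pow, ENNReal.ofReal_toReal, h1]
  exact ENNReal.pow_ne_top hg.eLpNorm_ne_top

/-- The vector is the class of `φ • w`. Thus weak convergence in `L²` gives convergence of the
integrals that define weak derivatives. -/
theorem exists_inner_toLp_eq {φ : ℝ → ℝ} (hφ : Continuous φ) (hp : Function.Periodic φ 1)
    (w : E3) : ∃ v : Lp E3 2 (volume : Measure UnitAddCircle),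
      ∀ (g : UnitAddCircle → E3) (hg : MemLp g 2),
        inner ℝ (hg.toLp g) v = inner ℝ w (∫ t in (0 : ℝ)..1, φ t • g t) := by
  have hc : Continuous (hp.lift : UnitAddCircle → ℝ) :=
    (QuotientAddGroup.isQuotientMap_mk (N := AddSubgroup.zmultiples (1 : ℝ))).continuous_iff.2 hφ
  have hm : MemLp (fun x : UnitAddCircle => hp.lift x • w) 2 :=
    memLp_of_continuous (hc.smul continuous_const)
  refine ⟨hm.toLp _, fun g hg => ?_⟩
  have h1 : (inner ℝ (hg.toLp g) (hm.toLp _) : ℝ) = ∫ x, inner ℝ (g x) (hp.lift x • w) := by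
    rw [L2.inner_def]
    refine integral_congr_ae ?_
    filter_upwards [hg.coeFn_toLp, hm.coeFn_toLp] with x hx hx'
    rw [hx, hx']
  rw [h1, ← UnitAddCircle.intervalIntegral_preimage 0, zero_add]
  have h2 := (innerSL ℝ w).intervalIntegral_comp_comm
    (intervalIntegrable_smul_coe hg.integrable_circle hφ)
  simp only [innerSL_apply_apply] at h2
  rw [← h2]
  refine intervalIntegral.integral_congr fun t _ => ?_
  simp only [inner_smul_right, real_inner_comm w]
  rfl

open Filter Topology in
theorem exists_weak_limit_circle (l : Ultrafilter ℕ) {g : ℕ → UnitAddCircle → E3}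
    (hg : ∀ n, MemLp (g n) 2) {b : ℝ≥0∞} (hb : b ≠ ⊤)
    {M : ℝ} (hM : ∀ n, ∫⁻ x, ‖g n x‖ₑ ^ 2 ≤ ENNReal.ofReal (M ^ 2))
    (hlim : Tendsto (fun n => ∫⁻ x, ‖g n x‖ₑ ^ 2) l (𝓝 b)) :
    ∃ g' : UnitAddCircle → E3, MemLp g' 2 ∧ ∫⁻ x, ‖g' x‖ₑ ^ 2 ≤ b ∧
      ∀ φ : ℝ → ℝ, Continuous φ → Function.Periodic φ 1 → ∀ w : E3,
        Tendsto (fun n => inner ℝ w (∫ t in (0 : ℝ)..1, φ t • g n t)) l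
          (𝓝 (inner ℝ w (∫ t in (0 : ℝ)..1, φ t • g' t))) := by
  set u : ℕ → Lp E3 2 (volume : Measure UnitAddCircle) := fun n => (hg n).toLp (g n) with hu
  have hM' : ∀ n, ‖u n‖ ≤ |M| := by
    intro n
    have := hM n
    rw [lintegral_enorm_sq_eq (hg n), ENNReal.ofReal_le_ofReal_iff (sq_nonneg _)] at this
    have h := sq_le_sq.1 this
    rwa [abs_of_nonneg (norm_nonneg _)] at h
  obtain ⟨v, hv⟩ := exists_weak_limit l u hM'
  refine ⟨v, Lp.memLp v, ?_, ?_⟩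
  · rw [lintegral_enorm_sq_eq (Lp.memLp v), Lp.toLp_coeFn]
    have h1 : Tendsto (fun n => ‖u n‖ ^ 2) l (𝓝 b.toReal) := by
      have h2 := (ENNReal.tendsto_toReal hb).comp hlim
      refine h2.congr fun n => ?_
      simp only [Function.comp_apply, lintegral_enorm_sq_eq (hg n)]
      exact ENNReal.toReal_ofReal (sq_nonneg _)
    refine ENNReal.ofReal_le_of_le_toReal ?_
    -- Lower semicontinuity of the norm: `2⟨u, v⟩ - ‖v‖² ≤ ‖u‖²`, and the left side is affine in
    -- `u`.
    have h3 : Tendsto (fun n => 2 * inner ℝ (u n) v - ‖v‖ ^ 2) l (𝓝 (‖v‖ ^ 2)) := by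
      have := ((hv v).const_mul 2).sub_const (‖v‖ ^ 2)
      rw [real_inner_self_eq_norm_sq] at this
      convert this using 2
      ring
    refine le_of_tendsto_of_tendsto h3 h1 (Eventually.of_forall fun n => ?_)
    have := norm_sub_sq_real (u n) v
    simp only
    nlinarith [sq_nonneg ‖u n - v‖]
  · intro φ h1 h2 w
    obtain ⟨p, hp⟩ := exists_inner_toLp_eq h1 h2 w
    have := hv p
    rw [← hp v (Lp.memLp v), Lp.toLp_coeFn]
    exact this.congr fun n => hp (g n) (hg n)

/-! ### Limits of unit loops -/

section
open Filter Topology BoundedContinuousFunction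

theorem exists_limit_of_holder (l : Ultrafilter ℕ) {W : ℕ → UnitAddCircle → E3}
    (hc : ∀ n, Continuous (W n)) (h1 : ∀ n x, ‖W n x‖ = 1) {B : ℝ}
    (hB : ∀ n x y, ‖W n x - W n y‖ ≤ B * √‖x - y‖) :
    ∃ W' : UnitAddCircle → E3, Continuous W' ∧ ∀ ε > 0, ∀ᶠ n in l, ∀ x, ‖W n x - W' x‖ ≤ ε := by
  set A : Set (UnitAddCircle →ᵇ E3) :=
    {f | (∀ x, ‖f x‖ ≤ 1) ∧ ∀ x y, ‖f x - f y‖ ≤ B * √‖x - y‖} with hA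
  have hcomp : IsCompact (closure A) := by
    refine arzela_ascoli (Metric.closedBall 0 1) (isCompact_closedBall _ _) A ?_ ?_
    · intro f x hf
      simpa using hf.1 x
    · refine Metric.equicontinuous_of_continuity_modulus (fun r => B * √r) ?_ _ ?_
      · have : Continuous fun r : ℝ => B * √r := by fun_prop
        simpa using this.tendsto 0
      · rintro x y ⟨f, hf⟩
        rw [dist_eq_norm, dist_eq_norm]
        exact hf.2 x y
  set w : ℕ → UnitAddCircle →ᵇ E3 := fun n => mkOfCompact ⟨W n, hc n⟩ with hw
  obtain ⟨W', -, hW'⟩ := hcomp.ultrafilter_le_nhds (l.map w) (by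
    rw [Filter.le_principal_iff, Ultrafilter.mem_coe, Ultrafilter.mem_map]
    exact Filter.univ_mem' fun n => subset_closure ⟨fun x => (h1 n x).le, hB n⟩)
  rw [Ultrafilter.coe_map] at hW'
  refine ⟨W', W'.continuous, fun ε hε => ?_⟩
  have h2 : ∀ᶠ n in (l : Filter ℕ), dist (w n) W' < ε := Metric.tendsto_nhds.1 hW' ε hε
  filter_upwards [h2] with n hn x
  rw [← dist_eq_norm]
  exact (dist_coe_le_dist x).trans hn.le

theorem tendsto_integral_smul {l : Filter ℕ} {W : ℕ → UnitAddCircle → E3} {W' : UnitAddCircle → E3}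
    (hc : ∀ n, Continuous (W n)) (hc' : Continuous W')
    (h : ∀ ε > 0, ∀ᶠ n in l, ∀ x, ‖W n x - W' x‖ ≤ ε) {ψ : ℝ → ℝ} (hψ : Continuous ψ) :
    Tendsto (fun n => ∫ t in (0 : ℝ)..1, ψ t • W n t) l (𝓝 (∫ t in (0 : ℝ)..1, ψ t • W' t)) := by
  obtain ⟨C, hC⟩ := isCompact_Icc.exists_bound_of_continuousOn (s := Icc (0 : ℝ) 1) hψ.continuousOn
  rw [Metric.tendsto_nhds]
  intro ε hε
  filter_upwards [h (ε / (2 * (|C| + 1))) (by positivity)] with n hn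
  rw [dist_eq_norm, ← intervalIntegral.integral_sub
    (intervalIntegrable_smul_coe (integrable_of_continuous (hc n)) hψ)
    (intervalIntegrable_smul_coe (integrable_of_continuous hc') hψ)]
  have := intervalIntegral.norm_integral_le_of_norm_le_const (a := (0 : ℝ)) (b := 1)
    (f := fun t : ℝ => ψ t • W n t - ψ t • W' t) (C := ε / 2) (fun t ht => by
      rw [uIoc_of_le zero_le_one] at ht
      rw [← smul_sub, norm_smul]
      calc ‖ψ t‖ * ‖W n t - W' t‖ ≤ (|C| + 1) * (ε / (2 * (|C| + 1))) := by
            gcongr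
            · exact (hC t ⟨ht.1.le, ht.2⟩).trans (by linarith [le_abs_self C])
            · exact hn _
        _ = ε / 2 := by field_simp)
  rw [sub_zero, abs_one, mul_one] at this
  linarith

/-- The mean value inequality along lifts realising the circle distance: uniformly close tangents
make the displacement a small Lipschitz function. -/
theorem norm_sub_sub_sub_le {γ γ' W W' : UnitAddCircle → E3} {ε : ℝ}
    (h : ∀ t : ℝ, HasDerivAt (fun s : ℝ => γ s) (W t) t)
    (h' : ∀ t : ℝ, HasDerivAt (fun s : ℝ => γ' s) (W' t) t) (hε : ∀ x, ‖W x - W' x‖ ≤ ε)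
    (x y : UnitAddCircle) : ‖(γ x - γ' x) - (γ y - γ' y)‖ ≤ ε * ‖x - y‖ := by
  obtain ⟨s, t, rfl, rfl, hst⟩ := exists_lifts y x
  rw [← hst]
  exact convex_univ.norm_image_sub_le_of_norm_hasDerivWithin_le
    (f := fun s : ℝ => γ s - γ' s) (f' := fun s : ℝ => W s - W' s)
    (fun u _ => ((h u).sub (h' u)).hasDerivWithinAt) (fun u _ => hε u) (mem_univ s) (mem_univ t)

theorem exists_loop_of_velocity {W : UnitAddCircle → E3} (hW : Continuous W)
    (h0 : ∫ t in (0 : ℝ)..1, W t = 0) : ∃ γ : UnitAddCircle → E3, Continuous γ ∧ γ 0 = 0 ∧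
      ∀ t : ℝ, HasDerivAt (fun s : ℝ => γ s) (W t) t := by
  have hWr : Continuous fun t : ℝ => W t := hW.comp (AddCircle.continuous_mk' 1)
  set G : ℝ → E3 := fun t => ∫ s in (0 : ℝ)..t, W s with hG
  have hper : Function.Periodic G 1 := by
    intro t
    have e1 := intervalIntegral.integral_add_adjacent_intervals
        (hWr.intervalIntegrable (μ := volume) 0 t) (hWr.intervalIntegrable t (t + 1))
    rw [(periodic_coe W).intervalIntegral_add_eq t 0, zero_add, h0, add_zero] at e1
    exact e1.symm
  have hder : ∀ t : ℝ, HasDerivAt G (W t) t := fun t =>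
    intervalIntegral.integral_hasDerivAt_right (hWr.intervalIntegrable 0 t)
        hWr.stronglyMeasurable.stronglyMeasurableAtFilter hWr.continuousAt
  refine ⟨hper.lift, continuous_coe_lift ?_ hper, ?_, fun t => hder t⟩
  · exact continuous_iff_continuousAt.2 fun t => (hder t).continuousAt
  · exact intervalIntegral.integral_same

/-- As `ε ≤ c / 2`, every curve on the segment from `γ` to `γ'` keeps the lower bound `c / 2`,
relative to which the displacement is `2 * ε / c`-Lipschitz. -/
theorem ambientIsotopic_of_close {γ γ' : UnitAddCircle → E3} {c ε : ℝ} (hε0 : 0 ≤ ε)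
    (hcε : 2 * ε ≤ c) (hc0 : 0 < c) (hc : ∀ x y, c * ‖x - y‖ ≤ ‖γ x - γ y‖)
    (h : ∀ x y, ‖(γ x - γ' x) - (γ y - γ' y)‖ ≤ ε * ‖x - y‖) :
    AmbientIsotopic (range γ) (range γ') := by
  have := AmbientIsotopic.of_linear_homotopy (P := γ) (f := γ' - γ) (κ := 2 * ε / c) (by
    rintro s ⟨hs0, hs1⟩ x y
    have h1 := h x y
    have h2 := hc x y
    have e1 : (γ' - γ) x - (γ' - γ) y = -((γ x - γ' x) - (γ y - γ' y)) := by
      simp only [Pi.sub_apply]; abel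
    have e2 : γ x + s • (γ' - γ) x - (γ y + s • (γ' - γ) y) =
        (γ x - γ y) - s • ((γ x - γ' x) - (γ y - γ' y)) := by
      simp only [Pi.sub_apply, smul_sub]; abel
    rw [e1, e2, norm_neg]
    generalize (γ x - γ' x) - (γ y - γ' y) = q at *
    have h3 := norm_sub_norm_le (γ x - γ y) (s • q)
    rw [norm_smul, Real.norm_of_nonneg hs0] at h3
    have h4 : s * ‖q‖ ≤ ‖q‖ := mul_le_of_le_one_left (norm_nonneg _) hs1
    have h5 : c / 2 * ‖x - y‖ ≤ ‖γ x - γ y - s • q‖ := by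
      nlinarith [norm_nonneg (x - y)]
    calc ‖q‖ ≤ ε * ‖x - y‖ := h1
      _ = 2 * ε / c * (c / 2 * ‖x - y‖) := by field_simp
      _ ≤ _ := by gcongr)
  rwa [add_sub_cancel] at this

theorem IsOfKnotType.injective {γ : UnitAddCircle → E3} {K : KnotClass} (h : IsOfKnotType γ K) :
    Function.Injective γ := by
  obtain ⟨k, rfl, -⟩ := h
  exact k.injective'

theorem IsOfKnotType.of_ambientIsotopic {γ γ' : UnitAddCircle → E3} {K : KnotClass}
    (h : IsOfKnotType γ K) (hc : Continuous γ') (hi : Function.Injective γ')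
    (hiso : AmbientIsotopic (range γ) (range γ')) : IsOfKnotType γ' K := by
  obtain ⟨k, rfl, rfl⟩ := h
  exact ⟨⟨γ', hc, hi⟩, rfl, Quotient.sound hiso.symm⟩

/-- Compactness and lower semicontinuity in one: energy-bounded sequences in the class have a limit
that stays in the class and does not gain energy. -/
theorem exists_unitLoop_of_tendsto {K : KnotClass} {θ : ℝ} (hθ : 0 < θ)
    {β : ℕ → UnitAddCircle → E3} (hβ : ∀ n, β n ∈ unitLoops K) {e C : ℝ≥0∞} (hC : C ≠ ⊤)
    (hle : ∀ n, totalEnergy θ (β n) ≤ C)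
    (hlim : Tendsto (fun n => totalEnergy θ (β n)) atTop (𝓝 e)) :
    ∃ γ ∈ unitLoops K, totalEnergy θ γ ≤ e := by
  set l : Ultrafilter ℕ := hyperfilter ℕ with hl
  have hl_le : (l : Filter ℕ) ≤ atTop := Nat.hyperfilter_le_atTop
  choose W g hWg using fun n => exists_unitSpeedH2 (hβ n).1 (hβ n).2.2.1
  have hinj : ∀ n, Function.Injective (β n) := fun n => (hβ n).2.2.2.injective
  -- By compactness of `[0, ∞]` both energies converge separately along the ultrafilter, so that `e
  -- = b + θ r` and each term can be treated on its own.
  obtain ⟨b, -, hb⟩ := isCompact_univ.ultrafilter_le_nhds (l.map fun n => bendingEnergy (β n))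
    (by simp)
  obtain ⟨r, -, hr⟩ := isCompact_univ.ultrafilter_le_nhds (l.map fun n => ropelength (β n))
    (by simp)
  rw [Ultrafilter.coe_map] at hb hr
  have hbC : ∀ n, bendingEnergy (β n) ≤ C := fun n => le_self_add.trans (hle n)
  have hrC : ∀ n, ropelength (β n) ≤ C / ENNReal.ofReal θ := fun n =>
    (ENNReal.le_div_iff_mul_le (Or.inl (by simpa using hθ)) (Or.inl ENNReal.ofReal_ne_top)).2
      (by rw [mul_comm]; exact le_add_self.trans (hle n))
  have hrth : ∀ n, ropelength (β n) = (thickness (β n))⁻¹ := fun n => by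
    rw [ropelength, (hWg n).length_eq, one_div]
  have he : b + ENNReal.ofReal θ * r = e := by
    refine tendsto_nhds_unique (f := fun n => totalEnergy θ (β n)) (l := (l : Filter ℕ)) ?_
      (hlim.mono_left hl_le)
    exact Tendsto.add hb (ENNReal.Tendsto.const_mul hr (Or.inr ENNReal.ofReal_ne_top))
  -- uniform bounds
  set B : ℝ := √C.toReal with hBdef
  have hB2 : ENNReal.ofReal (B ^ 2) = C := by
    rw [hBdef, Real.sq_sqrt ENNReal.toReal_nonneg, ENNReal.ofReal_toReal hC]
  have hg2 : ∀ n, ∫⁻ x, ‖g n x‖ₑ ^ 2 ≤ ENNReal.ofReal (B ^ 2) := fun n => by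
    rw [hB2, ← (hWg n).bendingEnergy_eq]
    exact hbC n
  have hH : ∀ n x y, ‖W n x - W n y‖ ≤ B * √‖x - y‖ := fun n =>
    (hWg n).holder_circle (Real.sqrt_nonneg _) (hg2 n)
  obtain ⟨d, hd0, hd⟩ : ∃ d : ℝ≥0, 0 < d ∧ ∀ n, (d : ℝ≥0∞) ≤ thickness (β n) := by
    have hne : C / ENNReal.ofReal θ ≠ ⊤ := ENNReal.div_ne_top hC (by simpa using hθ)
    obtain ⟨d, hd0, hd⟩ := ENNReal.lt_iff_exists_nnreal_btwn.1 (ENNReal.inv_pos.2 hne)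
    refine ⟨d, by exact_mod_cast hd0, fun n => ?_⟩
    have := hrC n
    rw [hrth] at this
    exact hd.le.trans (ENNReal.inv_le_iff_inv_le.1 this)
  obtain ⟨δ, hδ0, hδ1, hδ⟩ : ∃ δ : ℝ, 0 < δ ∧ δ ≤ 1 / 2 ∧ B * √δ ≤ 1 / 2 := by
    have hB0 : 0 ≤ B := Real.sqrt_nonneg _
    refine ⟨(1 / (2 * (B + 1))) ^ 2, by positivity, ?_, ?_⟩
    · have : 1 / (2 * (B + 1)) ≤ 1 / 2 := by
        gcongr; linarith
      have h0 : 0 ≤ 1 / (2 * (B + 1)) := by positivity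
      nlinarith
    · rw [Real.sqrt_sq (by positivity), mul_one_div, div_le_div_iff₀ (by positivity) (by norm_num)]
      linarith
  set c : ℝ := min δ (4 * d) with hcdef
  have hc0 : 0 < c := lt_min hδ0 (by positivity)
  have hlow : ∀ n x y, c * ‖x - y‖ ≤ ‖β n x - β n y‖ := fun n =>
    (hWg n).lower_bound (hinj n) (Real.sqrt_nonneg _) (hH n) hδ0 hδ1 hδ (by exact_mod_cast hd0)
      ((le_thickness_iff (hinj n) d).1 (hd n))
  -- the limit
  obtain ⟨W', hW'c, hW'⟩ := exists_limit_of_holder l (fun n => (hWg n).contW)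
    (fun n => (hWg n).norm_eq) hH
  have hb' : b ≠ ⊤ := by
    have : b ≤ C := le_of_tendsto hb (Eventually.of_forall hbC)
    exact (this.trans_lt hC.lt_top).ne
  have hbg : Tendsto (fun n => ∫⁻ x, ‖g n x‖ₑ ^ 2) l (𝓝 b) :=
    Tendsto.congr (fun n => (hWg n).bendingEnergy_eq) hb
  obtain ⟨g', hg'm, hg'b, hg'⟩ := exists_weak_limit_circle l (fun n => (hWg n).memLp) hb' hg2 hbg
  have hW'0 : ∫ t in (0 : ℝ)..1, W' t = 0 := by
    have h1 := tendsto_integral_smul (fun n => (hWg n).contW) hW'c hW'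
      (continuous_const (y := (1 : ℝ)))
    simp only [one_smul, (hWg _).weak_left.integral_eq_zero] at h1
    exact tendsto_nhds_unique h1 tendsto_const_nhds
  obtain ⟨γ, hγc, hγ0, hγd⟩ := exists_loop_of_velocity hW'c hW'0
  have hptW : ∀ x, Tendsto (fun n => W n x) l (𝓝 (W' x)) := by
    intro x
    rw [Metric.tendsto_nhds]
    intro ε hε
    filter_upwards [hW' (ε / 2) (by positivity)] with n hn
    rw [dist_eq_norm]
    linarith [hn x]
  have hpt : ∀ x, Tendsto (fun n => β n x) l (𝓝 (γ x)) := by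
    intro x
    rw [Metric.tendsto_nhds]
    intro ε hε
    filter_upwards [hW' (ε / 2) (by positivity)] with n hn
    have := norm_sub_sub_sub_le (hWg n).hasDerivAt hγd hn x 0
    rw [hγ0, (hβ n).2.1, sub_zero, sub_zero, sub_zero] at this
    rw [dist_eq_norm]
    nlinarith [norm_circle_le_half x]
  have hweak : HasWeakDeriv W' g' := by
    intro φ h1 h2
    have hφd : Continuous (deriv φ) := (contDiff_infty_iff_deriv.1 h1).2.continuous
    refine ext_inner_left ℝ fun w => ?_
    have t1 := ((innerSL ℝ w).continuous.tendsto _).comp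
      (tendsto_integral_smul (fun n => (hWg n).contW) hW'c hW' hφd)
    have t2 := (hg' φ h1.continuous h2 w).neg
    rw [inner_neg_right]
    refine tendsto_nhds_unique t1 (t2.congr fun n => ?_)
    simp only [Function.comp_apply, innerSL_apply_apply]
    rw [(hWg n).weak φ h1 h2, inner_neg_right]
  have hprim : ∃ c : E3, ∀ t : ℝ, W' t = c + ∫ s in (0 : ℝ)..t, g' s := by
    obtain ⟨F, hFc, hFW, c, hF⟩ := hweak.exists_primitive (integrable_of_continuous hW'c)
      hg'm.integrable_circle
    have : F = W' := (hFc.ae_eq_iff_eq volume hW'c).1 hFW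
    exact ⟨c, this ▸ hF⟩
  have hγU : UnitSpeedH2 γ W' g' := by
    refine ⟨hγc, hW'c, hg'm, hγd, fun x => ?_, hweak, hprim⟩
    refine tendsto_nhds_unique (hptW x).norm ?_
    simp only [(hWg _).norm_eq]
    exact tendsto_const_nhds
  have hγlow : ∀ x y, c * ‖x - y‖ ≤ ‖γ x - γ y‖ := fun x y =>
    ge_of_tendsto ((hpt x).sub (hpt y)).norm (Eventually.of_forall fun n => hlow n x y)
  have hγinj : Function.Injective γ := by
    intro x y hxy
    have := hγlow x y
    rw [hxy, sub_self, norm_zero] at this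
    have h0 : ‖x - y‖ ≤ 0 := by
      by_contra! h
      nlinarith
    exact sub_eq_zero.1 (norm_le_zero_iff.1 h0)
  -- One loop with tangent within `c / 2` of the limit tangent suffices to identify the knot type.
  obtain ⟨n, hn⟩ := (hW' (c / 2) (by positivity)).exists
  have hiso : AmbientIsotopic (range (β n)) (range γ) :=
    ambientIsotopic_of_close (ε := c / 2) (by positivity) (by linarith) hc0 (hlow n)
      (norm_sub_sub_sub_le (hWg n).hasDerivAt hγd hn)
  refine ⟨γ, ⟨hγU.memH2, hγ0, hγU.norm_velocity,
    (hβ n).2.2.2.of_ambientIsotopic hγc hγinj hiso⟩, ?_⟩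
  have hrγ : ropelength γ ≤ r := by
    rw [ropelength, hγU.length_eq, one_div, ENNReal.inv_le_iff_inv_le]
    -- Every `d'` below the limit `r⁻¹` of the thicknesses eventually bounds them from below, and
    -- the three point condition for `d'` passes to `γ`.
    refine ENNReal.le_of_forall_nnreal_lt fun d' hd' => ?_
    rw [le_thickness_iff hγinj]
    intro u v w
    refine ThreePoint.of_tendsto (hpt u) (hpt v) (hpt w) ?_
    have ht : Tendsto (fun n => thickness (β n)) l (𝓝 r⁻¹) := by
      have := ((continuous_inv (G := ℝ≥0∞)).tendsto r).comp hr
      refine this.congr fun n => ?_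
      simp [hrth]
    filter_upwards [ht.eventually (lt_mem_nhds hd')] with m hm
    exact (le_thickness_iff (hinj m) d').1 hm.le u v w
  rw [← he, totalEnergy, hγU.bendingEnergy_eq]
  gcongr

end

/-! ### Smoothing locally monotone loops -/

/-- On every interval of radius `δ` the curve `p` advances at rate at least `c` in some
direction. -/
def LocallyMonotone (p : ℝ → E3) (δ c : ℝ) : Prop :=
  ∀ x : ℝ, ∃ w : E3, ‖w‖ ≤ 1 ∧ ∀ s ∈ Icc (x - δ) (x + δ), ∀ t ∈ Icc (x - δ) (x + δ), s ≤ t →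
    c * (t - s) ≤ inner ℝ w (p t - p s)

/-- `q` is an average of the translates of `p` by at most `ε`, with nonnegative weights of total
mass 1. Lipschitz bounds and lower bounds on linear functionals of increments survive averaging; the
last clause will transfer local monotonicity. -/
theorem exists_mollification {p : ℝ → E3} {M : ℝ} (hM : ∀ s t, ‖p t - p s‖ ≤ M * |t - s|)
    (hp : Function.Periodic p 1) {ε : ℝ} (hε : 0 < ε) :
    ∃ q : ℝ → E3, ContDiff ℝ ∞ q ∧ Function.Periodic q 1 ∧ (∀ t, ‖q t - p t‖ ≤ M * ε) ∧
      (∀ s t, ‖q t - q s‖ ≤ M * |t - s|) ∧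
      ∀ w s t a, (∀ r, |r| ≤ ε → a ≤ inner ℝ w (p (t - r) - p (s - r))) →
        a ≤ inner ℝ w (q t - q s) := by
  have hpc : Continuous p := by
    refine (LipschitzWith.of_dist_le_mul (K := M.toNNReal) fun s t => ?_).continuous
    rw [dist_eq_norm, dist_eq_norm, Real.norm_eq_abs]
    exact (hM t s).trans (by gcongr; exact Real.le_coe_toNNReal M)
  have hM0 : 0 ≤ M := by
    have := (norm_nonneg _).trans (hM 0 1)
    simpa using this
  let f : ContDiffBump (0 : ℝ) := ⟨ε / 2, ε, by positivity, by linarith⟩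
  set φ : ℝ → ℝ := f.normed volume with hφ
  have hφ0 : ∀ r, 0 ≤ φ r := f.nonneg_normed
  have hφc : Continuous φ := f.continuous_normed
  have hφs : HasCompactSupport φ := f.hasCompactSupport_normed
  have hφ1 : ∫ r, φ r = 1 := f.integral_normed
  have hsupp : ∀ r, ε < |r| → φ r = 0 := by
    intro r hr
    by_contra h
    have : r ∈ Metric.ball (0 : ℝ) ε := f.support_normed_eq (μ := volume) ▸ h
    rw [mem_ball_zero_iff, Real.norm_eq_abs] at this
    linarith
  have hφI : Integrable φ := f.integrable_normed
  have hint : ∀ F : ℝ → E3, Continuous F → Integrable fun r => φ r • F r := fun F hF =>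
    (hφc.smul hF).integrable_of_hasCompactSupport hφs.smul_right
  have havg : ∀ (F : ℝ → E3) (a : ℝ), (∀ r, |r| ≤ ε → ‖F r‖ ≤ a) → ‖∫ r, φ r • F r‖ ≤ a := by
    intro F a h
    calc ‖∫ r, φ r • F r‖ ≤ ∫ r, φ r * a := by
          refine norm_integral_le_of_norm_le (hφI.mul_const a) (Filter.Eventually.of_forall ?_)
          intro r
          rw [norm_smul, Real.norm_of_nonneg (hφ0 r)]
          rcases le_or_gt |r| ε with hr | hr
          · exact mul_le_mul_of_nonneg_left (h r hr) (hφ0 r)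
          · simp [hsupp r hr]
      _ = a := by rw [integral_mul_const, hφ1, one_mul]
  set q : ℝ → E3 := fun t => ∫ r, φ r • p (t - r) with hq
  have hqsub : ∀ s t, q t - q s = ∫ r, φ r • (p (t - r) - p (s - r)) := by
    intro s t
    simp only [smul_sub]
    rw [integral_sub (hint _ (by fun_prop)) (hint _ (by fun_prop))]
  refine ⟨q, ?_, ?_, ?_, ?_, ?_⟩
  · have := hφs.contDiff_convolution_left (μ := volume) (n := ⊤) (ContinuousLinearMap.lsmul ℝ ℝ)
      f.contDiff_normed (hpc.locallyIntegrable (μ := volume))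
    exact this
  · intro t
    simp only [hq]
    congr 1
    ext1 r
    rw [show t + 1 - r = t - r + 1 by ring, hp]
  · intro t
    have e : q t - p t = ∫ r, φ r • (p (t - r) - p t) := by
      simp only [smul_sub]
      rw [integral_sub (hint _ (by fun_prop)) (hint _ (by fun_prop)), integral_smul_const, hφ1,
        one_smul]
    rw [e]
    refine havg _ _ fun r hr => (hM _ _).trans ?_
    rw [show t - r - t = -r by ring, abs_neg]
    gcongr
  · intro s t
    rw [hqsub]
    refine havg _ _ fun r _ => (hM _ _).trans ?_
    rw [show t - r - (s - r) = t - s by ring]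
  · intro w s t a h
    rw [hqsub]
    have hF := hint (fun r => p (t - r) - p (s - r)) (by fun_prop)
    have h1 := (innerSL ℝ w).integral_comp_comm hF
    simp only [innerSL_apply_apply] at h1
    rw [← h1]
    calc a = ∫ r, φ r * a := by rw [integral_mul_const, hφ1, one_mul]
      _ ≤ _ := by
          refine integral_mono (hφI.mul_const a) ((innerSL ℝ w).integrable_comp hF) ?_
          intro r
          simp only [inner_smul_right]
          rcases le_or_gt |r| ε with hr | hr
          · exact mul_le_mul_of_nonneg_left (h r hr) (hφ0 r)
          · simp [hsupp r hr]

theorem exists_far_bound {P : UnitAddCircle → E3} (hc : Continuous P) (hi : Function.Injective P)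
    {δ : ℝ} (hδ : 0 < δ) : ∃ m > 0, ∀ x y, δ ≤ ‖x - y‖ → m ≤ ‖P x - P y‖ := by
  set S : Set (UnitAddCircle × UnitAddCircle) := {z | δ ≤ ‖z.1 - z.2‖} with hS
  have hSc : IsCompact S :=
    (isClosed_le continuous_const (continuous_fst.sub continuous_snd).norm).isCompact
  rcases S.eq_empty_or_nonempty with hemp | hne
  · refine ⟨1, one_pos, fun x y h => ?_⟩
    have : (x, y) ∈ S := h
    simp [hemp] at this
  · obtain ⟨z, hz, hmin⟩ := hSc.exists_isMinOn hne (f := fun z => ‖P z.1 - P z.2‖)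
      (by fun_prop)
    refine ⟨‖P z.1 - P z.2‖, norm_pos_iff.2 (sub_ne_zero.2 (hi.ne ?_)), fun x y h => ?_⟩
    · intro h
      have : δ ≤ ‖z.1 - z.2‖ := hz
      rw [h, sub_self, norm_zero] at this
      linarith
    · exact hmin (a := (x, y)) h

/-- For close parameters, `P` and its mollification advance at rate `c` in the same direction `w`,
hence so do their convex combinations. Parameters farther apart have images at distance at least
`m`, and moving each by at most `m / 4` leaves `m / 2`. So the linear homotopy is uniformly
bi-Lipschitz from below, while the displacement is `2 * M`-Lipschitz. -/
theorem exists_smooth_loop {P : UnitAddCircle → E3} (hPc : Continuous P)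
    (hPi : Function.Injective P) {M δ c : ℝ} (hδ : 0 < δ) (hc : 0 < c)
    (hM : ∀ s t : ℝ, ‖P t - P s‖ ≤ M * |t - s|)
    (hmono : LocallyMonotone (fun t : ℝ => P t) δ c) :
    ∃ Q : UnitAddCircle → E3, ContDiff ℝ ∞ (fun t : ℝ => Q t) ∧
      (∃ c' > 0, ∀ x y, c' * ‖x - y‖ ≤ ‖Q x - Q y‖) ∧ AmbientIsotopic (range P) (range Q) := by
  obtain ⟨m, hm0, hm⟩ := exists_far_bound hPc hPi (half_pos hδ)
  have hM0 : 0 ≤ M := by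
    have := (norm_nonneg _).trans (hM 0 1)
    simpa using this
  -- `ε ≤ δ / 2` keeps translates of a pair at distance at most `δ / 2` inside one interval of
  -- monotonicity; `M * ε ≤ m / 4` controls the far pairs.
  obtain ⟨ε, hε0, hεδ, hεm⟩ : ∃ ε : ℝ, 0 < ε ∧ ε ≤ δ / 2 ∧ M * ε ≤ m / 4 := by
    refine ⟨min (δ / 2) (m / (4 * (M + 1))), by positivity, min_le_left _ _, ?_⟩
    calc M * min (δ / 2) (m / (4 * (M + 1))) ≤ (M + 1) * (m / (4 * (M + 1))) := by
          gcongr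
          · linarith
          · exact min_le_right _ _
      _ = m / 4 := by field_simp
  obtain ⟨q, hq, hqp, hqP, hqM, hqw⟩ := exists_mollification hM (periodic_coe P) hε0
  set Q : UnitAddCircle → E3 := hqp.lift with hQ
  have hQt : ∀ t : ℝ, Q t = q t := fun t => rfl
  have hQP : ∀ x, ‖Q x - P x‖ ≤ m / 4 := by
    intro x
    obtain ⟨t, rfl⟩ := QuotientAddGroup.mk_surjective x
    exact (hqP t).trans hεm
  have key : ∀ s ∈ Icc (0 : ℝ) 1, ∀ x y, min c m * ‖x - y‖ ≤
      ‖(P x + s • (Q - P) x) - (P y + s • (Q - P) y)‖ := by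
    rintro s ⟨hs0, hs1⟩ x y
    rcases le_or_gt ‖x - y‖ (δ / 2) with hxy | hxy
    · have hlift : ∀ a b : ℝ, a ≤ b → b - a ≤ δ / 2 → c * (b - a) ≤
          ‖(P b + s • (Q - P) b) - (P a + s • (Q - P) a)‖ := by
        intro a b hab hab2
        obtain ⟨w, hw1, hw⟩ := hmono a
        have h1 : c * (b - a) ≤ inner ℝ w (P b - P a) :=
          hw a ⟨by linarith, by linarith⟩ b ⟨by linarith, by linarith⟩ hab
        have h2 : c * (b - a) ≤ inner ℝ w (q b - q a) := hqw w a b _ fun r hr => by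
          have hr' := abs_le.1 hr
          have := hw (a - r) ⟨by linarith, by linarith⟩ (b - r) ⟨by linarith, by linarith⟩
            (by linarith)
          rwa [show b - r - (a - r) = b - a by ring] at this
        have e : (P b + s • (Q - P) b) - (P a + s • (Q - P) a) =
            (1 - s) • (P b - P a) + s • (q b - q a) := by
          simp only [Pi.sub_apply, hQt, sub_smul, smul_sub, one_smul]; abel
        rw [e]
        refine le_trans ?_ ((real_inner_le_norm w _).trans
          (mul_le_of_le_one_left (norm_nonneg _) hw1))
        rw [inner_add_right, inner_smul_right, inner_smul_right]
        nlinarith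
      obtain ⟨a, b, rfl, rfl, hab⟩ := exists_lifts x y
      rw [norm_sub_rev, ← hab] at hxy ⊢
      refine (mul_le_mul_of_nonneg_right (min_le_left c m) (abs_nonneg _)).trans ?_
      rcases le_total a b with h | h
      · rw [abs_of_nonneg (by linarith)] at hxy ⊢
        rw [norm_sub_rev]
        exact hlift a b h hxy
      · rw [abs_of_nonpos (by linarith)] at hxy ⊢
        rw [neg_sub] at hxy ⊢
        exact hlift b a h hxy
    · have h1 := hm x y hxy.le
      have e : (P x + s • (Q - P) x) - (P y + s • (Q - P) y) =
          (P x - P y) - (s • (Q y - P y) - s • (Q x - P x)) := by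
        simp only [Pi.sub_apply]; abel
      rw [e]
      have h2 := norm_sub_norm_le (P x - P y) (s • (Q y - P y) - s • (Q x - P x))
      have h3 := norm_sub_le (s • (Q y - P y)) (s • (Q x - P x))
      have h4 : ∀ z, ‖s • (Q z - P z)‖ ≤ m / 4 := fun z => by
        rw [norm_smul, Real.norm_of_nonneg hs0]
        exact (mul_le_of_le_one_left (norm_nonneg _) hs1).trans (hQP z)
      have h5 : min c m * ‖x - y‖ ≤ m * (1 / 2) :=
        mul_le_mul (min_le_right _ _) (norm_circle_le_half _) (norm_nonneg _) hm0.le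
      linarith [h4 x, h4 y]
  have hmin : 0 < min c m := lt_min hc hm0
  refine ⟨Q, hq, ⟨min c m, hmin, fun x y => ?_⟩, ?_⟩
  · simpa using key 1 ⟨zero_le_one, le_rfl⟩ x y
  · have := AmbientIsotopic.of_linear_homotopy (P := P) (f := Q - P) (κ := 2 * M / min c m) (by
      intro s hs x y
      have h1 := key s hs x y
      have h2 : ‖(Q - P) x - (Q - P) y‖ ≤ 2 * M * ‖x - y‖ := by
        obtain ⟨a, b, rfl, rfl, hab⟩ := exists_lifts y x
        rw [← hab]
        have e : (Q - P) b - (Q - P) a = (q b - q a) - (P b - P a) := by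
          simp only [Pi.sub_apply, hQt]; abel
        rw [e]
        linarith [norm_sub_le (q b - q a) (P b - P a), hM a b, hqM a b]
      calc _ ≤ 2 * M * ‖x - y‖ := h2
        _ = 2 * M / min c m * (min c m * ‖x - y‖) := by field_simp
        _ ≤ _ := by gcongr)
    rwa [add_sub_cancel] at this

/-! ### Arclength parametrisation -/

/-- Along the linear homotopy the scaling factor `1 + s * (a - 1)` stays at least `min 1 a > 0`. -/
theorem AmbientIsotopic.affine {X : Type*} (P : X → E3) {a : ℝ} (ha : 0 < a) (v : E3) :
    AmbientIsotopic (range P) (range fun x => a • P x + v) := by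
  have := AmbientIsotopic.of_linear_homotopy (P := P) (f := fun x => (a - 1) • P x + v)
    (κ := |a - 1| / min 1 a) (by
      rintro s ⟨hs0, hs1⟩ x y
      have hmin : 0 < min 1 a := lt_min one_pos ha
      have e1 : (a - 1) • P x + v - ((a - 1) • P y + v) = (a - 1) • (P x - P y) := by
        rw [smul_sub]; abel
      have e2 : P x + s • ((a - 1) • P x + v) - (P y + s • ((a - 1) • P y + v)) =
          (1 + s * (a - 1)) • (P x - P y) := by
        module
      have h1 : min 1 a ≤ 1 + s * (a - 1) := by
        nlinarith [min_le_left 1 a, min_le_right 1 a]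
      rw [e1, e2, norm_smul, norm_smul, Real.norm_eq_abs, Real.norm_of_nonneg (hmin.le.trans h1)]
      calc |a - 1| * ‖P x - P y‖ = |a - 1| / min 1 a * (min 1 a * ‖P x - P y‖) := by field_simp
        _ ≤ _ := by gcongr)
  convert this using 2
  ext1 x
  simp only [Pi.add_apply]
  module

theorem deriv_ne_zero_of_lower_bound {q : ℝ → E3} {c : ℝ} {v : E3} (hc : 0 < c) {t : ℝ}
    (hq : HasDerivAt q v t) (h : ∀ᶠ s in nhds t, c * |s - t| ≤ ‖q s - q t‖) : v ≠ 0 := by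
  have h1 := hq.tendsto_slope.norm
  have h2 : c ≤ ‖v‖ := by
    refine ge_of_tendsto h1 ?_
    filter_upwards [self_mem_nhdsWithin, mem_nhdsWithin_of_mem_nhds h] with s hs hs2
    have hst : 0 < |s - t| := abs_pos.2 (sub_ne_zero.2 hs)
    rw [slope_def_module, norm_smul, norm_inv, Real.norm_eq_abs, ← div_eq_inv_mul,
      le_div_iff₀ hst]
    exact hs2
  rintro rfl
  rw [norm_zero] at h2
  linarith

/-- The inverse of the normalised arclength of a regular periodic curve. -/
theorem exists_arclength_inverse {ρ : ℝ → ℝ} (hρ : Continuous ρ) (hpos : ∀ t, 0 < ρ t)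
    (hper : Function.Periodic ρ 1) : ∃ L > 0, ∃ τ : ℝ → ℝ, Function.Surjective τ ∧
      StrictMono τ ∧ (∀ x, τ (x + 1) = τ x + 1) ∧ ∀ x, HasDerivAt τ (L / ρ (τ x)) x := by
  set L := ∫ t in (0 : ℝ)..1, ρ t with hL
  have hL0 : 0 < L := intervalIntegral.intervalIntegral_pos_of_pos (hρ.intervalIntegrable _ _)
    hpos zero_lt_one
  set S : ℝ → ℝ := fun t => (∫ u in (0 : ℝ)..t, ρ u) / L with hS
  have hder : ∀ t, HasDerivAt S (ρ t / L) t := fun t =>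
    (intervalIntegral.integral_hasDerivAt_right (hρ.intervalIntegrable 0 t)
        hρ.stronglyMeasurable.stronglyMeasurableAtFilter hρ.continuousAt).div_const L
  have hSc : Continuous S := continuous_iff_continuousAt.2 fun t => (hder t).continuousAt
  have hmono : StrictMono S := strictMono_of_hasDerivAt_pos hder fun t => div_pos (hpos t) hL0
  have hSp : ∀ t, S (t + 1) = S t + 1 := by
    intro t
    have e1 := intervalIntegral.integral_add_adjacent_intervals
        (hρ.intervalIntegrable (μ := volume) 0 t) (hρ.intervalIntegrable t (t + 1))
    rw [hper.intervalIntegral_add_eq t 0, zero_add, ← hL] at e1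
    simp only [hS]
    rw [← e1, add_div, div_self hL0.ne']
  have hSn : ∀ (n : ℕ) t, S (t + n) = S t + n := by
    intro n t
    induction n with
    | zero => simp
    | succ n ih => push_cast; rw [← add_assoc, hSp, ih, add_assoc]
  have hS0 : S 0 = 0 := by simp [hS]
  have hsurj : Function.Surjective S := by
    intro y
    obtain ⟨n, hn⟩ := exists_nat_ge |y|
    have h1 : S n = n := by have := hSn n 0; rwa [zero_add, hS0, zero_add] at this
    have h2 : S (-n) = -n := by
      have := hSn n (-n)
      rw [neg_add_cancel, hS0] at this
      linarith
    have hn' := abs_le.1 hn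
    obtain ⟨t, -, ht⟩ := intermediate_value_Icc (a := -(n : ℝ)) (b := n) (by linarith [hn'.1, hn'.2])
      hSc.continuousOn (show y ∈ Icc (S (-n)) (S n) by rw [h1, h2]; exact hn')
    exact ⟨t, ht⟩
  set E := hmono.orderIsoOfSurjective S hsurj with hE
  have hES : ∀ t, E t = S t := fun t => rfl
  have hSE : ∀ x, S (E.symm x) = x := fun x => E.apply_symm_apply x
  refine ⟨L, hL0, E.symm, E.symm.surjective, E.symm.strictMono, fun x => ?_, fun x => ?_⟩
  · apply hmono.injective
    rw [hSE, hSp, hSE]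
  · have := HasDerivAt.of_local_left_inverse (f := S) (g := E.symm) (a := x)
      E.symm.continuous.continuousAt (hder _) (div_pos (hpos _) hL0).ne'
      (Filter.Eventually.of_forall hSE)
    rwa [inv_div] at this

/-- The lower bound forces a nonvanishing velocity, so normalised arclength has a differentiable
inverse `τ`. Scaling by `L⁻¹` makes the length 1, and `τ (x + 1) = τ x + 1` lets everything descend
to the circle. The trace changes only by an affine map. -/
theorem exists_unit_loop {Q : UnitAddCircle → E3} (hQ : ContDiff ℝ ∞ (fun t : ℝ => Q t))
    {c : ℝ} (hc : 0 < c) (hlow : ∀ x y, c * ‖x - y‖ ≤ ‖Q x - Q y‖) :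
    ∃ γ W g : UnitAddCircle → E3, UnitSpeedH2 γ W g ∧ γ 0 = 0 ∧ Function.Injective γ ∧
      AmbientIsotopic (range Q) (range γ) := by
  set q : ℝ → E3 := fun t => Q t with hq
  obtain ⟨hqd, hq'⟩ := contDiff_infty_iff_deriv.1 hQ
  have hqp : Function.Periodic q 1 := periodic_coe Q
  have hq'p : Function.Periodic (deriv q) 1 := by
    intro t
    have : (fun s => q (s + 1)) = q := funext hqp
    rw [← deriv_comp_add_const, this]
  have hne : ∀ t, deriv q t ≠ 0 := by
    intro t
    refine deriv_ne_zero_of_lower_bound hc (hqd t).hasDerivAt ?_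
    filter_upwards [Metric.ball_mem_nhds t (show (0 : ℝ) < 1 / 2 by norm_num)] with s hs
    rw [mem_ball_iff_norm, Real.norm_eq_abs] at hs
    have h1 : ‖((s - t : ℝ) : UnitAddCircle)‖ = |s - t| :=
      (AddCircle.norm_coe_eq_abs_iff (1 : ℝ) one_ne_zero).2 (by simpa using hs.le)
    rw [← h1, AddCircle.coe_sub]
    exact hlow _ _
  have hρC : ContDiff ℝ ∞ fun t => ‖deriv q t‖ := hq'.norm ℝ hne
  obtain ⟨L, hL, τ, hτs, hτm, hτ1, hτd⟩ := exists_arclength_inverse (ρ := fun t => ‖deriv q t‖)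
    hρC.continuous (fun t => norm_pos_iff.2 (hne t)) (fun t => by simp only [hq'p t])
  have hτc : Continuous τ := continuous_iff_continuousAt.2 fun t => (hτd t).continuousAt
  -- unit tangent
  set T : ℝ → E3 := fun t => ‖deriv q t‖⁻¹ • deriv q t with hT
  have hTC : ContDiff ℝ ∞ T := (hρC.inv fun t => (norm_pos_iff.2 (hne t)).ne').smul hq'
  have hTp : Function.Periodic T 1 := fun t => by simp only [hT, hq'p t]
  obtain ⟨hTd, hT'⟩ := contDiff_infty_iff_deriv.1 hTC
  have hT'p : Function.Periodic (deriv T) 1 := by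
    intro t
    have : (fun s => T (s + 1)) = T := funext hTp
    rw [← deriv_comp_add_const, this]
  set γr : ℝ → E3 := fun x => L⁻¹ • q (τ x) + -(L⁻¹ • q (τ 0)) with hγr
  set Wr : ℝ → E3 := fun x => T (τ x) with hWr
  set gr : ℝ → E3 := fun x => (L / ‖deriv q (τ x)‖) • deriv T (τ x) with hgr
  have hγp : Function.Periodic γr 1 := fun x => by simp only [hγr, hτ1, hqp (τ x)]
  have hWp : Function.Periodic Wr 1 := fun x => by simp only [hWr, hτ1, hTp (τ x)]
  have hgp : Function.Periodic gr 1 := fun x => by simp only [hgr, hτ1, hq'p (τ x), hT'p (τ x)]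
  have hγd : ∀ x, HasDerivAt γr (Wr x) x := by
    intro x
    have h1 := (((hqd (τ x)).hasDerivAt.scomp x (hτd x)).const_smul L⁻¹).add_const (-(L⁻¹ • q (τ 0)))
    have e : Wr x = L⁻¹ • ((L / ‖deriv q (τ x)‖) • deriv q (τ x)) := by
      simp only [hWr, hT, smul_smul]
      congr 1
      field_simp
    rw [e]
    exact h1
  have hWd : ∀ x, HasDerivAt Wr (gr x) x := fun x => (hTd (τ x)).hasDerivAt.scomp x (hτd x)
  have hgc : Continuous gr :=
    (continuous_const.div (hρC.continuous.comp hτc) fun x => (norm_pos_iff.2 (hne _)).ne').smul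
      (hT'.continuous.comp hτc)
  have hγc : Continuous γr := continuous_iff_continuousAt.2 fun t => (hγd t).continuousAt
  have hWc : Continuous Wr := continuous_iff_continuousAt.2 fun t => (hWd t).continuousAt
  have hgl : Continuous (hgp.lift : UnitAddCircle → E3) := continuous_coe_lift hgc hgp
  have hprim : ∀ t : ℝ, Wr t = Wr 0 + ∫ s in (0 : ℝ)..t, gr s := by
    intro t
    rw [intervalIntegral.integral_eq_sub_of_hasDerivAt (fun s _ => hWd s)
      (hgc.intervalIntegrable _ _)]
    abel
  have hg0 : ∫ s in (0 : ℝ)..1, gr s = 0 := by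
    have h1 := hprim 1
    have h2 := hWp 0
    rw [zero_add] at h2
    rw [h2] at h1
    simpa using h1.symm
  have hγQ : ∀ x : ℝ, (hγp.lift : UnitAddCircle → E3) x = L⁻¹ • Q (τ x) + -(L⁻¹ • q (τ 0)) :=
    fun x => rfl
  have hQi : Function.Injective Q := by
    intro x y hxy
    have := hlow x y
    rw [hxy, sub_self, norm_zero] at this
    have h0 : ‖x - y‖ ≤ 0 := by
      by_contra! h
      nlinarith
    exact sub_eq_zero.1 (norm_le_zero_iff.1 h0)
  have hτz : ∀ (x : ℝ) (n : ℤ), τ (x + n) = τ x + n := by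
    intro x n
    have hp : Function.Periodic (fun x => τ x - x) 1 := fun x => by simp only [hτ1]; ring
    have := hp.int_mul n x
    simp only [mul_one] at this
    linarith
  refine ⟨hγp.lift, hWp.lift, hgp.lift, ⟨continuous_coe_lift hγc hγp, continuous_coe_lift hWc hWp,
    memLp_of_continuous hgl, hγd, ?_, ?_, Wr 0, hprim⟩, ?_, ?_, ?_⟩
  · intro x
    obtain ⟨t, rfl⟩ := QuotientAddGroup.mk_surjective x
    change ‖Wr t‖ = 1
    simp only [hWr, hT, norm_smul, norm_inv, norm_norm]
    exact inv_mul_cancel₀ (norm_pos_iff.2 (hne _)).ne'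
  · exact HasWeakDeriv.of_primitive (integrable_of_continuous hgl) hg0 hprim
  · change γr 0 = 0
    simp [hγr]
  · intro x y hxy
    obtain ⟨s, rfl⟩ := QuotientAddGroup.mk_surjective x
    obtain ⟨t, rfl⟩ := QuotientAddGroup.mk_surjective y
    have h1 : L⁻¹ • Q (τ s) + -(L⁻¹ • q (τ 0)) = L⁻¹ • Q (τ t) + -(L⁻¹ • q (τ 0)) := hxy
    have h2 : (τ s : UnitAddCircle) = τ t :=
      hQi (smul_right_injective E3 (inv_ne_zero hL.ne') (add_right_cancel h1))
    rw [← sub_eq_zero, ← AddCircle.coe_sub, AddCircle.coe_eq_zero_iff] at h2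
    obtain ⟨n, hn⟩ := h2
    rw [zsmul_one] at hn
    have h3 : s = t + n := hτm.injective (by rw [hτz]; linarith)
    have h4 : ((n : ℝ) : UnitAddCircle) = 0 :=
      AddCircle.coe_eq_zero_iff (1 : ℝ) |>.2 ⟨n, by simp⟩
    change (s : UnitAddCircle) = t
    rw [h3, AddCircle.coe_add, h4, add_zero]
  · have h1 := AmbientIsotopic.affine Q (inv_pos.2 hL) (-(L⁻¹ • q (τ 0)))
    convert h1 using 1
    ext z
    constructor
    · rintro ⟨x, rfl⟩
      obtain ⟨s, rfl⟩ := QuotientAddGroup.mk_surjective x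
      exact ⟨(τ s : UnitAddCircle), rfl⟩
    · rintro ⟨x, rfl⟩
      obtain ⟨t, rfl⟩ := QuotientAddGroup.mk_surjective x
      obtain ⟨s, rfl⟩ := hτs t
      exact ⟨(s : UnitAddCircle), rfl⟩

/-! ### Polygons -/

theorem coe_add_intCast (y : ℝ) (n : ℤ) : ((y + n : ℝ) : UnitAddCircle) = y := by
  have h4 : ((n : ℝ) : UnitAddCircle) = 0 :=
    AddCircle.coe_eq_zero_iff (1 : ℝ) |>.2 ⟨n, by simp⟩
  rw [AddCircle.coe_add, h4, add_zero]

theorem exists_slope_of_lineMap {γ : UnitAddCircle → E3} {a b : ℝ} (hab : a < b)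
    (h : ∀ s ∈ Icc (0 : ℝ) 1, γ ((AffineMap.lineMap a b s : ℝ) : UnitAddCircle) =
        AffineMap.lineMap (γ (a : UnitAddCircle)) (γ (b : UnitAddCircle)) s) :
    ∃ u : E3, ∀ y ∈ Icc a b, ∀ z ∈ Icc a b, γ z = γ y + (z - y) • u := by
  have hba : 0 < b - a := sub_pos.2 hab
  set u : E3 := (b - a)⁻¹ • (γ b - γ a) with hu
  have key : ∀ y ∈ Icc a b, γ y = γ a + (y - a) • u := by
    intro y hy
    have h1 := h ((y - a) / (b - a)) ⟨div_nonneg (by linarith [hy.1]) hba.le,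
      (div_le_one hba).2 (by linarith [hy.2])⟩
    have h2 : (AffineMap.lineMap a b ((y - a) / (b - a)) : ℝ) = y := by
      rw [AffineMap.lineMap_apply, vsub_eq_sub, smul_eq_mul, vadd_eq_add,
        div_mul_cancel₀ _ hba.ne', sub_add_cancel]
    rw [h2, AffineMap.lineMap_apply, vsub_eq_sub, vadd_eq_add] at h1
    rw [h1, hu, smul_smul, ← div_eq_mul_inv, add_comm]
  refine ⟨u, fun y hy z hz => ?_⟩
  rw [key y hy, key z hz]
  module

theorem IsPolygon.exists_right_slope {γ : UnitAddCircle → E3} (h : IsPolygon γ) (x : ℝ) :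
    ∃ δ > 0, ∃ u : E3, ∀ r ∈ Icc 0 δ, γ (x + r : ℝ) = γ x + r • u := by
  obtain ⟨n, t, -, h0, h1, haff⟩ := h
  set y := Int.fract x with hy
  -- The subdivision may repeat points; the strict inequality selects a nondegenerate piece
  -- extending to the right of `y`.
  obtain ⟨i, hi, hty, hyt⟩ : ∃ i < n, t i ≤ y ∧ y < t (i + 1) := by
    by_contra! hcon
    have : ∀ i ≤ n, t i ≤ y := by
      intro i
      induction i with
      | zero => intro _; rw [h0]; exact Int.fract_nonneg x
      | succ i ih => intro hi; exact hcon i hi (ih (by omega))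
    have h2 := this n le_rfl
    rw [h1] at h2
    exact absurd (Int.fract_lt_one x) (not_lt.2 h2)
  obtain ⟨u, hu⟩ := exists_slope_of_lineMap (hty.trans_lt hyt) (haff i hi)
  refine ⟨t (i + 1) - y, sub_pos.2 hyt, u, fun r hr => ?_⟩
  have e : ∀ r, (((x + r : ℝ)) : UnitAddCircle) = ((y + r : ℝ) : UnitAddCircle) := by
    intro r
    rw [← coe_add_intCast (y + r) ⌊x⌋]
    congr 1
    rw [hy]
    linarith [Int.fract_add_floor x]
  have e0 := e 0
  rw [add_zero, add_zero] at e0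
  rw [e, e0, hu y ⟨hty, hyt.le⟩ (y + r) ⟨by linarith [hr.1], by linarith [hr.2]⟩, add_sub_cancel_left]

theorem IsPolygon.exists_left_slope {γ : UnitAddCircle → E3} (h : IsPolygon γ) (x : ℝ) :
    ∃ δ > 0, ∃ v : E3, ∀ r ∈ Icc 0 δ, γ (x - r : ℝ) = γ x - r • v := by
  obtain ⟨n, t, -, h0, h1, haff⟩ := h
  -- The representative of `x` in `(0, 1]`, so that there is room to its left even when `x` is an
  -- integer.
  set y := 1 - Int.fract (-x) with hy
  have hy0 : 0 < y := sub_pos.2 (Int.fract_lt_one _)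
  have hy1 : y ≤ 1 := sub_le_self _ (Int.fract_nonneg _)
  obtain ⟨i, hi, hty, hyt⟩ : ∃ i < n, t i < y ∧ y ≤ t (i + 1) := by
    by_contra! hcon
    have : ∀ i ≤ n, t i < y := by
      intro i
      induction i with
      | zero => intro _; rw [h0]; exact hy0
      | succ i ih => intro hi; exact hcon i hi (ih (by omega))
    have h2 := this n le_rfl
    rw [h1] at h2
    exact absurd hy1 (not_le.2 h2)
  obtain ⟨v, hv⟩ := exists_slope_of_lineMap (hty.trans_le hyt) (haff i hi)
  refine ⟨y - t i, sub_pos.2 hty, v, fun r hr => ?_⟩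
  have e : ∀ r, (((x - r : ℝ)) : UnitAddCircle) = ((y - r : ℝ) : UnitAddCircle) := by
    intro r
    rw [← coe_add_intCast (y - r) (-⌊-x⌋ - 1)]
    congr 1
    rw [hy]
    push_cast
    linarith [Int.fract_add_floor (-x)]
  have e0 := e 0
  rw [sub_zero, sub_zero] at e0
  rw [e, e0, hv y ⟨hty.le, hyt⟩ (y - r) ⟨by linarith [hr.2], by linarith [hr.1]⟩]
  module

/-- Two nonzero vectors that are not opposite to each other advance in a common direction. -/
theorem exists_common_direction {u v : E3} (hu : u ≠ 0) (hv : v ≠ 0)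
    (huv : ‖u‖⁻¹ • u + ‖v‖⁻¹ • v ≠ 0) :
    ∃ w : E3, ‖w‖ ≤ 1 ∧ 0 < inner ℝ w u ∧ 0 < inner ℝ w v := by
  have hu0 := norm_pos_iff.2 hu
  have hv0 := norm_pos_iff.2 hv
  set a := ‖u‖⁻¹ • u with ha
  set b := ‖v‖⁻¹ • v with hb
  have ha1 : ‖a‖ = 1 := by rw [ha, norm_smul, norm_inv, norm_norm, inv_mul_cancel₀ hu0.ne']
  have hb1 : ‖b‖ = 1 := by rw [hb, norm_smul, norm_inv, norm_norm, inv_mul_cancel₀ hv0.ne']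
  have hua : u = ‖u‖ • a := by rw [ha, smul_smul, mul_inv_cancel₀ hu0.ne', one_smul]
  have hvb : v = ‖v‖ • b := by rw [hb, smul_smul, mul_inv_cancel₀ hv0.ne', one_smul]
  have hpos : 0 < 1 + inner ℝ a b := by
    have h1 := norm_add_sq_real a b
    have h2 : 0 < ‖a + b‖ ^ 2 := by have := norm_pos_iff.2 huv; positivity
    rw [ha1, hb1] at h1
    linarith
  -- Half the sum of the unit vectors: its inner product with either one is `(1 + ⟨a, b⟩) / 2`.
  refine ⟨(1 / 2 : ℝ) • (a + b), ?_, ?_, ?_⟩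
  · rw [norm_smul, Real.norm_of_nonneg (by norm_num)]
    have := norm_add_le a b
    linarith
  · rw [hua, real_inner_smul_left, real_inner_smul_right, inner_add_left,
      real_inner_self_eq_norm_sq, ha1, real_inner_comm a b]
    nlinarith
  · rw [hvb, real_inner_smul_left, real_inner_smul_right, inner_add_left,
      real_inner_self_eq_norm_sq, hb1]
    nlinarith

/-- Near `x` the curve consists of two straight pieces. Injectivity makes both slopes nonzero and
prevents them from being opposite, so both advance along a common direction. -/
theorem IsPolygon.exists_local {γ : UnitAddCircle → E3} (h : IsPolygon γ)
    (hinj : Function.Injective γ) (x : ℝ) :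
    ∃ δ > 0, ∃ c > 0, ∃ M : ℝ, ∃ w : E3, ‖w‖ ≤ 1 ∧
      ∀ s ∈ Icc (x - δ) (x + δ), ∀ t ∈ Icc (x - δ) (x + δ), s ≤ t →
        c * (t - s) ≤ inner ℝ w (γ t - γ s) ∧ ‖γ t - γ s‖ ≤ M * (t - s) := by
  obtain ⟨δ₁, hδ₁, u, hu⟩ := h.exists_right_slope x
  obtain ⟨δ₂, hδ₂, v, hv⟩ := h.exists_left_slope x
  have hne : ∀ {a b : ℝ}, a ≠ b → |b - a| ≤ 1 / 2 → γ a ≠ γ b := by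
    intro a b hab hle heq
    have h1 := hinj heq
    have h2 : ‖((b - a : ℝ) : UnitAddCircle)‖ = |b - a| :=
      (AddCircle.norm_coe_eq_abs_iff (1 : ℝ) one_ne_zero).2 (by simpa using hle)
    rw [AddCircle.coe_sub, h1, sub_self, norm_zero] at h2
    exact hab (sub_eq_zero.1 (abs_eq_zero.1 h2.symm)).symm
  have hu0 : u ≠ 0 := by
    rintro rfl
    have := hu (min δ₁ (1 / 2)) ⟨by positivity, min_le_left _ _⟩
    rw [smul_zero, add_zero] at this
    refine hne (a := x) (b := x + min δ₁ (1 / 2)) ?_ ?_ this.symm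
    · have : 0 < min δ₁ (1 / 2) := by positivity
      linarith
    · rw [add_sub_cancel_left, abs_of_nonneg (by positivity)]
      exact min_le_right _ _
  have hv0 : v ≠ 0 := by
    rintro rfl
    have := hv (min δ₂ (1 / 2)) ⟨by positivity, min_le_left _ _⟩
    rw [smul_zero, sub_zero] at this
    have hp : 0 < min δ₂ (1 / 2) := by positivity
    refine hne (a := x) (b := x - min δ₂ (1 / 2)) ?_ ?_ this.symm
    · linarith
    · rw [sub_sub_cancel_left, abs_neg, abs_of_nonneg hp.le]
      exact min_le_right _ _
  have hun := norm_pos_iff.2 hu0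
  have hvn := norm_pos_iff.2 hv0
  have huv : ‖u‖⁻¹ • u + ‖v‖⁻¹ • v ≠ 0 := by
    intro h0
    -- If the curve doubled back, the points at distance `r` from `γ x` on the two edges would
    -- coincide. The bounds 1/4 keep their parameters within half a period, hence distinct on the
    -- circle.
    obtain ⟨r, hr0, hr1, hr2, hr3, hr4⟩ : ∃ r : ℝ, 0 < r ∧ r * ‖u‖⁻¹ ≤ δ₁ ∧ r * ‖v‖⁻¹ ≤ δ₂ ∧
        r * ‖u‖⁻¹ ≤ 1 / 4 ∧ r * ‖v‖⁻¹ ≤ 1 / 4 := by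
      refine ⟨min (min (δ₁ * ‖u‖) (δ₂ * ‖v‖)) (min (1 / 4 * ‖u‖) (1 / 4 * ‖v‖)),
        by positivity, ?_, ?_, ?_, ?_⟩ <;> rw [← div_eq_mul_inv, div_le_iff₀ (by assumption)]
      · exact (min_le_left _ _).trans (min_le_left _ _)
      · exact (min_le_left _ _).trans (min_le_right _ _)
      · exact (min_le_right _ _).trans (min_le_left _ _)
      · exact (min_le_right _ _).trans (min_le_right _ _)
    have h1 := hu (r * ‖u‖⁻¹) ⟨by positivity, hr1⟩
    have h2 := hv (r * ‖v‖⁻¹) ⟨by positivity, hr2⟩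
    have h3 : γ (x + r * ‖u‖⁻¹ : ℝ) = γ (x - r * ‖v‖⁻¹ : ℝ) := by
      rw [h1, h2, ← sub_eq_zero]
      have : γ x + (r * ‖u‖⁻¹) • u - (γ x - (r * ‖v‖⁻¹) • v) = r • (‖u‖⁻¹ • u + ‖v‖⁻¹ • v) := by
        module
      rw [this, h0, smul_zero]
    have hp1 : 0 < r * ‖u‖⁻¹ := by positivity
    have hp2 : 0 < r * ‖v‖⁻¹ := by positivity
    refine hne ?_ ?_ h3
    · linarith
    · rw [abs_le]; constructor <;> linarith
  obtain ⟨w, hw1, hwu, hwv⟩ := exists_common_direction hu0 hv0 huv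
  have hur : ∀ t, x ≤ t → t ≤ x + δ₁ → γ t = γ x + (t - x) • u := fun t h1 h2 => by
    have := hu (t - x) ⟨by linarith, by linarith⟩
    rwa [add_sub_cancel] at this
  have hvl : ∀ t, t ≤ x → x - δ₂ ≤ t → γ t = γ x - (x - t) • v := fun t h1 h2 => by
    have := hv (x - t) ⟨by linarith, by linarith⟩
    rwa [sub_sub_cancel] at this
  refine ⟨min δ₁ δ₂, lt_min hδ₁ hδ₂, min (inner ℝ w u) (inner ℝ w v), lt_min hwu hwv,
    max ‖u‖ ‖v‖, w, hw1, ?_⟩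
  rintro s ⟨hs1, hs2⟩ t ⟨ht1, ht2⟩ hst
  have hm1 := min_le_left δ₁ δ₂
  have hm2 := min_le_right δ₁ δ₂
  have hc1 := min_le_left (inner ℝ w u) (inner ℝ w v)
  have hc2 := min_le_right (inner ℝ w u) (inner ℝ w v)
  have hM1 := le_max_left ‖u‖ ‖v‖
  have hM2 := le_max_right ‖u‖ ‖v‖
  generalize min (inner ℝ w u) (inner ℝ w v) = c at *
  generalize max ‖u‖ ‖v‖ = M at *
  -- the increment is a nonnegative combination of the two slopes
  obtain ⟨α, β, hα, hβ, hαβ, he⟩ : ∃ α β : ℝ, 0 ≤ α ∧ 0 ≤ β ∧ α + β = t - s ∧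
      γ t - γ s = α • u + β • v := by
    rcases le_total x s with h1 | h1
    · refine ⟨t - s, 0, by linarith, le_rfl, by ring, ?_⟩
      rw [hur s h1 (by linarith), hur t (h1.trans hst) (by linarith)]
      module
    · rcases le_total x t with h2 | h2
      · refine ⟨t - x, x - s, by linarith, by linarith, by ring, ?_⟩
        rw [hvl s h1 (by linarith), hur t h2 (by linarith)]
        module
      · refine ⟨0, t - s, le_rfl, by linarith, by ring, ?_⟩
        rw [hvl s h1 (by linarith), hvl t h2 (by linarith)]
        module
  rw [he, ← hαβ]
  constructor
  · rw [inner_add_right, real_inner_smul_right, real_inner_smul_right]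
    nlinarith
  · refine (norm_add_le _ _).trans ?_
    rw [norm_smul, norm_smul, Real.norm_of_nonneg hα, Real.norm_of_nonneg hβ]
    nlinarith

/-- Compactness of `[0, 1]` makes the local constants uniform and periodicity carries them to `ℝ`.
The global Lipschitz bound uses the local one for gaps up to `δ` and boundedness of `γ` beyond. -/
theorem IsPolygon.exists_uniform {γ : UnitAddCircle → E3} (h : IsPolygon γ) (hc : Continuous γ)
    (hinj : Function.Injective γ) : ∃ δ > 0, ∃ c > 0, ∃ M : ℝ,
      LocallyMonotone (fun t : ℝ => γ t) δ c ∧ ∀ s t : ℝ, ‖γ t - γ s‖ ≤ M * |t - s| := by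
  have key : ∃ δ > 0, ∃ c > 0, ∃ M : ℝ, ∀ x ∈ Icc (0 : ℝ) 1, ∃ w : E3, ‖w‖ ≤ 1 ∧
      ∀ s ∈ Icc (x - δ) (x + δ), ∀ t ∈ Icc (x - δ) (x + δ), s ≤ t →
        c * (t - s) ≤ inner ℝ w (γ t - γ s) ∧ ‖γ t - γ s‖ ≤ M * (t - s) := by
    refine isCompact_Icc.induction_on (p := fun S : Set ℝ => ∃ δ > 0, ∃ c > 0, ∃ M : ℝ,
      ∀ x ∈ S, ∃ w : E3, ‖w‖ ≤ 1 ∧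
      ∀ s ∈ Icc (x - δ) (x + δ), ∀ t ∈ Icc (x - δ) (x + δ), s ≤ t →
        c * (t - s) ≤ inner ℝ w (γ t - γ s) ∧ ‖γ t - γ s‖ ≤ M * (t - s)) ?_ ?_ ?_ ?_
    · exact ⟨1, one_pos, 1, one_pos, 0, fun x hx => absurd hx (notMem_empty x)⟩
    · rintro S T hST ⟨δ, hδ, c, hc, M, H⟩
      exact ⟨δ, hδ, c, hc, M, fun x hx => H x (hST hx)⟩
    · rintro S T ⟨δ, hδ, c, hc, M, H⟩ ⟨δ', hδ', c', hc', M', H'⟩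
      refine ⟨min δ δ', lt_min hδ hδ', min c c', lt_min hc hc', max M M', ?_⟩
      have d1 := min_le_left δ δ'
      have d2 := min_le_right δ δ'
      rintro x (hx | hx)
      · obtain ⟨w, hw, hH⟩ := H x hx
        refine ⟨w, hw, fun s hs t ht hst => ?_⟩
        obtain ⟨h1, h2⟩ := hH s ⟨by linarith [hs.1], by linarith [hs.2]⟩ t
          ⟨by linarith [ht.1], by linarith [ht.2]⟩ hst
        have hst' := sub_nonneg.2 hst
        exact ⟨(mul_le_mul_of_nonneg_right (min_le_left _ _) hst').trans h1,
          h2.trans (mul_le_mul_of_nonneg_right (le_max_left _ _) hst')⟩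
      · obtain ⟨w, hw, hH⟩ := H' x hx
        refine ⟨w, hw, fun s hs t ht hst => ?_⟩
        obtain ⟨h1, h2⟩ := hH s ⟨by linarith [hs.1], by linarith [hs.2]⟩ t
          ⟨by linarith [ht.1], by linarith [ht.2]⟩ hst
        have hst' := sub_nonneg.2 hst
        exact ⟨(mul_le_mul_of_nonneg_right (min_le_right _ _) hst').trans h1,
          h2.trans (mul_le_mul_of_nonneg_right (le_max_right _ _) hst')⟩
    · intro x _
      obtain ⟨δ, hδ, c, hc, M, w, hw, H⟩ := h.exists_local hinj x
      refine ⟨Icc (x - δ / 2) (x + δ / 2), mem_nhdsWithin_of_mem_nhds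
        (Icc_mem_nhds (by linarith) (by linarith)), δ / 2, by positivity, c, hc, M, ?_⟩
      intro y hy
      exact ⟨w, hw, fun s hs t ht hst => H s ⟨by linarith [hs.1, hy.1], by linarith [hs.2, hy.2]⟩ t
        ⟨by linarith [ht.1, hy.1], by linarith [ht.2, hy.2]⟩ hst⟩
  obtain ⟨δ, hδ, c, hc0, M, H⟩ := key
  have Hall : ∀ x : ℝ, ∃ w : E3, ‖w‖ ≤ 1 ∧
      ∀ s ∈ Icc (x - δ) (x + δ), ∀ t ∈ Icc (x - δ) (x + δ), s ≤ t →
        c * (t - s) ≤ inner ℝ w (γ t - γ s) ∧ ‖γ t - γ s‖ ≤ M * (t - s) := by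
    intro x
    obtain ⟨w, hw, hH⟩ := H (Int.fract x) ⟨Int.fract_nonneg x, (Int.fract_lt_one x).le⟩
    refine ⟨w, hw, fun s hs t ht hst => ?_⟩
    have hfr := Int.fract_add_floor x
    have := hH (s - ⌊x⌋) ⟨by linarith [hs.1], by linarith [hs.2]⟩ (t - ⌊x⌋)
      ⟨by linarith [ht.1], by linarith [ht.2]⟩ (by linarith)
    rw [← coe_add_intCast (s - ⌊x⌋) ⌊x⌋, ← coe_add_intCast (t - ⌊x⌋) ⌊x⌋, sub_add_cancel,
      sub_add_cancel, sub_sub_sub_cancel_right] at this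
    exact this
  obtain ⟨C, hC⟩ := isCompact_univ.exists_bound_of_continuousOn (s := univ) hc.continuousOn
  have hC0 : 0 ≤ C := (norm_nonneg _).trans (hC 0 (mem_univ _))
  have hlip : ∀ s t : ℝ, s ≤ t → ‖γ t - γ s‖ ≤ max M (2 * C / δ) * (t - s) := by
    intro s t hst
    have hst' := sub_nonneg.2 hst
    rcases le_or_gt (t - s) δ with h1 | h1
    · obtain ⟨w, -, hw⟩ := Hall s
      exact (hw s ⟨by linarith, by linarith⟩ t ⟨by linarith, by linarith⟩ hst).2.trans
        (mul_le_mul_of_nonneg_right (le_max_left _ _) hst')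
    · calc ‖γ t - γ s‖ ≤ 2 * C := by
            linarith [norm_sub_le (γ t) (γ s), hC t (mem_univ _), hC s (mem_univ _)]
        _ = 2 * C / δ * δ := by field_simp
        _ ≤ _ := by
            gcongr
            exact le_max_right _ _
  refine ⟨δ, hδ, c, hc0, max M (2 * C / δ), fun x => ?_, fun s t => ?_⟩
  · obtain ⟨w, hw, hH⟩ := Hall x
    exact ⟨w, hw, fun s hs t ht hst => (hH s hs t ht hst).1⟩
  · rcases le_total s t with h1 | h1
    · rw [abs_of_nonneg (by linarith)]
      exact hlip s t h1
    · rw [abs_of_nonpos (by linarith), neg_sub, norm_sub_rev]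
      exact hlip t s h1

/-! ### Competitors and minimizing sequences -/

theorem unitLoops_nonempty {K : KnotClass} (hK : K.IsTame) : (unitLoops K).Nonempty := by
  obtain ⟨k, hpoly, hk⟩ := hK
  obtain ⟨δ, hδ, c, hc, M, hmono, hM⟩ := hpoly.exists_uniform k.continuous' k.injective'
  obtain ⟨Q, hQ, ⟨c', hc', hlow⟩, hiso⟩ :=
    exists_smooth_loop k.continuous' k.injective' hδ hc hM hmono
  obtain ⟨γ, W, g, hγ, hγ0, hγi, hiso'⟩ := exists_unit_loop hQ hc' hlow
  have hkK : IsOfKnotType k.toFun K := ⟨k, rfl, hk⟩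
  exact ⟨γ, hγ.memH2, hγ0, hγ.norm_velocity,
    hkK.of_ambientIsotopic hγ.cont hγi (hiso.trans hiso')⟩

open Filter Topology in
theorem exists_minimizing_sequence {S : Set (UnitAddCircle → E3)}
    {F : (UnitAddCircle → E3) → ℝ≥0∞} (hF : (⨅ β ∈ S, F β) ≠ ⊤) :
    ∃ β : ℕ → UnitAddCircle → E3, (∀ n, β n ∈ S) ∧ (∀ n, F (β n) ≤ (⨅ β ∈ S, F β) + 1) ∧
      Tendsto (fun n => F (β n)) atTop (𝓝 (⨅ β ∈ S, F β)) := by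
  set e := ⨅ β ∈ S, F β with he
  have h : ∀ n : ℕ, ∃ β ∈ S, F β < e + ((n : ℝ≥0∞) + 1)⁻¹ := by
    intro n
    have hlt : e < e + ((n : ℝ≥0∞) + 1)⁻¹ := ENNReal.lt_add_right hF (by simp)
    conv_lhs at hlt => rw [he]
    simpa only [iInf_lt_iff, exists_prop] using hlt
  choose β hβ hβe using h
  refine ⟨β, hβ, fun n => (hβe n).le.trans ?_, ?_⟩
  · gcongr
    rw [ENNReal.inv_le_one]
    exact le_add_self
  · refine tendsto_of_tendsto_of_tendsto_of_le_of_le tendsto_const_nhds ?_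
      (fun n => iInf₂_le (β n) (hβ n)) (fun n => (hβe n).le)
    have h1 := (ENNReal.tendsto_inv_nat_nhds_zero.comp (tendsto_add_atTop_nat 1)).const_add e
    rw [add_zero] at h1
    refine h1.congr fun n => ?_
    simp

end SpringyKnots

theorem mainTheorem6 (K : SpringyKnots.KnotClass) (hK : K.IsTame) (θ : ℝ) (hθ : 0 < θ) :
    ∃ γ ∈ SpringyKnots.unitLoops K,
      SpringyKnots.totalEnergy θ γ =
        ⨅ β ∈ SpringyKnots.unitLoops K, SpringyKnots.totalEnergy θ β := by
  -- Treating an infinite infimum separately avoids showing that some competitor has finite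
  -- ropelength.
  by_cases htop : (⨅ β ∈ SpringyKnots.unitLoops K, SpringyKnots.totalEnergy θ β) = ⊤
  · obtain ⟨γ, hγ⟩ := SpringyKnots.unitLoops_nonempty hK
    refine ⟨γ, hγ, le_antisymm (by rw [htop]; exact le_top) (iInf₂_le γ hγ)⟩
  · obtain ⟨β, hβ, hle, hlim⟩ := SpringyKnots.exists_minimizing_sequence htop
    obtain ⟨γ, hγ, hγe⟩ := SpringyKnots.exists_unitLoop_of_tendsto hθ hβ
      (ENNReal.add_ne_top.2 ⟨htop, ENNReal.one_ne_top⟩) hle hlim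
    exact ⟨γ, hγ, le_antisymm hγe (iInf₂_le γ hγ)⟩
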